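/- **Setting.** Let $(X,d)$ be a metric space with a $\sigma$-algebra containing the Borel sets, $\mu$ a probability measure on $X$, and $T:X\to X$ a Lipschitz map preserving $\mu$. Assume that $T$ has super-polynomial decay of correlations: there is a sequence $(\theta_n)$ with $n^k\theta_n\to0$ for every $k$ such that for all bounded Lipschitz functions $\varphi_1,\varphi_2:X\to\mathbb R$ and all $n\ge1$ $$\Big|\int_X\varphi_1\circ T^n\,\varphi_2\,d\mu-\int_X\varphi_1\,d\mu\int_X\varphi_2\,d\mu\Big|\le\|\varphi_1\|\,\|\varphi_2\|\,\theta_n ,$$ where $\|\cdot\|$ is the Lipschitz norm (supremum norm plus least Lipschitz constant). Let $\phi:X\to(0,\infty)$ be measurable and $\mu$-integrable. Let $Y=\{(u,s):0\le s\le\phi(u)\}$ with $(u,\phi(u))$ and $(Tu,0)$ identified; every class is represented by its unique member with $0\le s<\phi(u)$, and $\pi(u,s)=u$ for that representative. Let $\nu_\mu$ be the normalization of $\mu\otimes\mathrm{Leb}$ on $Y$, and let $\Phi_t(u,s)=(u,s+t)$, $t\ge0$, be the suspension flow (defined for all $t\geq 0$ at $\nu_\mu$-a.e. point). Give $Y$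 the Bowen–Walters distance: for $\phi\equiv1$ it is the infimum of the lengths of finite paths made of horizontal segments from $(x,t)$ to $(y,t)$, of length $(1-t)\,d(x,y)+t\,d(Tx,Ty)$, and of vertical segments along orbits, whose length is time; for general $\phi$ it is the distance between the rescaled points $(x,s/\phi(x))$. For a flow (or semiflow) $\Psi$ on a set $Z$, $f:Z\to\mathbb R^N$, $p\in\mathbb N$ and $x\in Z$, put $\tau_{r,p}^{\Psi,f,\star}(x)=\inf\{t>p: f(\Psi_tx)\in B(f(x),r)\}\in[0,\infty]$ and $$\underline R_\star^{\Psi,f}(x)=\lim_{p\to\infty}\liminf_{r\to0}\frac{\log\tau_{r,p}^{\Psi,f,\star}(x)}{-\log r},\qquad \overline R_\star^{\Psi,f}(x)=\lim_{p\to\infty}\limsup_{r\to0}\frac{\log\tau_{r,p}^{\Psi,f,\star}(x)}{-\log r}.$$ For $F:Y\to\mathbb R^N$ and $z\in\mathbb R^N$, let $\underline d_\mu^{F}(z)$ and $\overline d_\mu^{F}(z)$ be the lower and the upper limit, as $r\to0$, of $\log\mu\big(\pi F^{-1}B(z,r)\big)/\log r$. These limits take values in $[-\infty,\infty]$. **Theorem.**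 (1) Let $M$ be a metric space with its Borel $\sigma$-algebra (for instance a compact Riemannian manifold with its Riemannian distance), $\Psi=(\Psi_t)_{t\in\mathbb R}$ a measurable flow on $M$, $\nu$ a $\Psi$-invariant Borel probability measure, and $f:M\to\mathbb R^N$ Lipschitz. Suppose that $(\Psi,\nu)$ is metrically isomorphic to $(\Phi,\nu_\mu)$ through a Lipschitz map $g:Y\to M$, that is: there are measurable sets $Y'\subset Y$ and $M'\subset M$ with $\nu_\mu(Y')=\nu(M')=1$ such that $g$ maps $Y'$ bijectively onto $M'$; $\Phi_t(Y')\subset Y'$ and $g\circ\Phi_t=\Psi_t\circ g$ on $Y'$ for all $t\ge0$; $\nu(A)=\nu_\mu(g^{-1}A)$ for all measurable $A\subset M$; and $\nu_\mu(B)=\nu(g(B))$ for all measurable $B\subset Y'$. Write $\underline d_\mu^{f,g}(x)=\underline d_\mu^{f\circ g}(f(x))$ and $\overline d_\mu^{f,g}(x)=\overline d_\mu^{f\circ g}(f(x))$ for the lower and upper local projection dimensions. Then $$\underline R_\star^{\Psi,f}(x)\ge\underline d_\mu^{f,g}(x)\qquad\text{and}\qquad\overline R_\star^{\Psi,f}(x)\ge\overline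 d_\mu^{f,g}(x)$$ for $\nu$-almost every $x\in M$ such that $\underline d_\mu^{f,g}(x)>0$. (2) Let $F:Y\to\mathbb R^N$ be Lipschitz. Then $$\underline R_\star^{\Phi,F}(y)\ge\underline d_\mu^{F}(F(y))\qquad\text{and}\qquad\overline R_\star^{\Phi,F}(y)\ge\overline d_\mu^{F}(F(y))$$ for $\nu_\mu$-almost every $y\in Y$ such that $\underline d_\mu^{F}(F(y))>0$. -/

import Mathlib

open MeasureTheory Filter Topology Set
open scoped NNReal ENNReal

noncomputable section

/-! ### Flows and non-instantaneous return times of an observation -/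

/-- A measurable flow `Ψ = (Ψ_t)`, `t ∈ ℝ`, on a measurable space. -/
structure IsMeasurableFlow {M : Type*} [MeasurableSpace M] (Ψ : ℝ → M → M) : Prop where
  measurable : Measurable (fun p : ℝ × M => Ψ p.1 p.2)
  map_zero : ∀ x, Ψ 0 x = x
  map_add : ∀ s t x, Ψ (s + t) x = Ψ s (Ψ t x)

/-- `τ_{r,p}(x) = inf {t > p : f (Ψ_t x) ∈ B(f x, r)}`, with value `∞` if there is no such `t`. -/
def returnTime {Z E : Type*} [PseudoMetricSpace E] (Ψ : ℝ → Z → Z) (f : Z → E)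
    (p : ℕ) (r : ℝ) (x : Z) : ℝ≥0∞ :=
  ⨅ (t : ℝ) (_ : (p : ℝ) < t ∧ f (Ψ t x) ∈ Metric.ball (f x) r), ENNReal.ofReal t

/-- `liminf_{r → 0} log τ_{r,p}(x) / (-log r)`. -/
def lowerRateFrom {Z E : Type*} [PseudoMetricSpace E] (Ψ : ℝ → Z → Z) (f : Z → E)
    (p : ℕ) (x : Z) : EReal :=
  liminf (fun r : ℝ => ENNReal.log (returnTime Ψ f p r x) / ((-Real.log r : ℝ) : EReal)) (𝓝[>] 0)

/-- `limsup_{r → 0} log τ_{r,p}(x) / (-log r)`. -/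
def upperRateFrom {Z E : Type*} [PseudoMetricSpace E] (Ψ : ℝ → Z → Z) (f : Z → E)
    (p : ℕ) (x : Z) : EReal :=
  limsup (fun r : ℝ => ENNReal.log (returnTime Ψ f p r x) / ((-Real.log r : ℝ) : EReal)) (𝓝[>] 0)

/-- The lower non-instantaneous recurrence rate. The expression is nondecreasing in `p`, so that
its limit as `p → ∞` is the supremum; see `tendsto_lowerRateFrom`. -/
def lowerRate {Z E : Type*} [PseudoMetricSpace E] (Ψ : ℝ → Z → Z) (f : Z → E) (x : Z) : EReal :=
  ⨆ p : ℕ, lowerRateFrom Ψ f p x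

/-- The upper non-instantaneous recurrence rate; see `tendsto_upperRateFrom`. -/
def upperRate {Z E : Type*} [PseudoMetricSpace E] (Ψ : ℝ → Z → Z) (f : Z → E) (x : Z) : EReal :=
  ⨆ p : ℕ, upperRateFrom Ψ f p x

theorem returnTime_mono {Z E : Type*} [PseudoMetricSpace E] (Ψ : ℝ → Z → Z) (f : Z → E)
    {p q : ℕ} (h : p ≤ q) (r : ℝ) (x : Z) : returnTime Ψ f p r x ≤ returnTime Ψ f q r x := by
  refine le_iInf₂ fun t ht => iInf₂_le t ⟨lt_of_le_of_lt ?_ ht.1, ht.2⟩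
  exact_mod_cast h

theorem eventually_rate_mono {Z E : Type*} [PseudoMetricSpace E] (Ψ : ℝ → Z → Z) (f : Z → E)
    {p q : ℕ} (h : p ≤ q) (x : Z) : ∀ᶠ r : ℝ in 𝓝[>] 0,
      ENNReal.log (returnTime Ψ f p r x) / ((-Real.log r : ℝ) : EReal) ≤
        ENNReal.log (returnTime Ψ f q r x) / ((-Real.log r : ℝ) : EReal) := by
  filter_upwards [Ioo_mem_nhdsGT (zero_lt_one (α := ℝ))] with r hr
  have h1 : (0 : ℝ) ≤ -Real.log r := by linarith [Real.log_nonpos hr.1.le hr.2.le]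
  exact EReal.div_le_div_right_of_nonneg (by exact_mod_cast h1)
    (ENNReal.log_monotone (returnTime_mono Ψ f h r x))

theorem tendsto_lowerRateFrom {Z E : Type*} [PseudoMetricSpace E] (Ψ : ℝ → Z → Z) (f : Z → E)
    (x : Z) : Tendsto (fun p => lowerRateFrom Ψ f p x) atTop (𝓝 (lowerRate Ψ f x)) :=
  tendsto_atTop_iSup fun _ _ h => liminf_le_liminf (eventually_rate_mono Ψ f h x)

theorem tendsto_upperRateFrom {Z E : Type*} [PseudoMetricSpace E] (Ψ : ℝ → Z → Z) (f : Z → E)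
    (x : Z) : Tendsto (fun p => upperRateFrom Ψ f p x) atTop (𝓝 (upperRate Ψ f x)) :=
  tendsto_atTop_iSup fun _ _ h => limsup_le_limsup (eventually_rate_mono Ψ f h x)

/-! ### The suspension (special) flow -/

/-- The space under the function `φ > 0`, where `(u, φ u)` is identified with `(T u, 0)`: each
class has exactly one representative `(u, s)` with `0 ≤ s < φ u`, and the space is represented by
these. It carries the σ-algebra induced from `X × ℝ`. -/
abbrev Susp {X : Type*} (φ : X → ℝ) : Type _ := {p : X × ℝ // 0 ≤ p.2 ∧ p.2 < φ p.1}

/-- The projection `π (u, s) = u`. -/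
def Susp.proj {X : Type*} {φ : X → ℝ} (p : Susp φ) : X := p.1.1

/-- The upward motion at unit speed leads from `p = (u, s)` to `q` in time `t`: the point
`(u, s + t)` becomes `(T^n u, s + t - ∑_{k < n} φ (T^k u))` through the identification. -/
def SuspReaches {X : Type*} (T : X → X) (φ : X → ℝ) (t : ℝ) (p q : Susp φ) : Prop :=
  ∃ n : ℕ, q.1.1 = T^[n] p.1.1 ∧ p.1.2 + t = birkhoffSum T φ n p.1.1 + q.1.2

theorem SuspReaches.unique {X : Type*} {T : X → X} {φ : X → ℝ} {t : ℝ}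
    {p q q' : Susp φ} (hφ : ∀ x, 0 < φ x) (h : SuspReaches T φ t p q)
    (h' : SuspReaches T φ t p q') : q = q' := by
  obtain ⟨n, h1, h2⟩ := h
  obtain ⟨m, h3, h4⟩ := h'
  have mono : Monotone (fun k => birkhoffSum T φ k p.1.1) :=
    monotone_nat_of_le_succ fun k => by
      rw [birkhoffSum_succ]; linarith [hφ (T^[k] p.1.1)]
  have key : ∀ {a b : ℕ} {y z : Susp φ}, y.1.1 = T^[a] p.1.1 →
      p.1.2 + t = birkhoffSum T φ a p.1.1 + y.1.2 →
      p.1.2 + t = birkhoffSum T φ b p.1.1 + z.1.2 → ¬ a < b := by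
    intro a b y z ha hy hz hab
    have := mono (Nat.succ_le_of_lt hab)
    simp only [Nat.succ_eq_add_one, birkhoffSum_succ] at this
    have h5 := y.2.2
    rw [ha] at h5
    linarith [z.2.1]
  have hnm : n = m := le_antisymm (not_lt.1 (key h3 h4 h2)) (not_lt.1 (key h1 h2 h4))
  subst hnm
  refine Subtype.ext (Prod.ext (h1.trans h3.symm) ?_)
  linarith

open Classical in
/-- The suspension flow `Φ_t`, `t ≥ 0`, over `T` with height function `φ`. The point reached is
unique, and it exists for all `t ≥ 0` unless `∑ k, φ (T^k u) < ∞`, which happens on a null set only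
(if `T` preserves a probability measure); there the value is irrelevant. -/
def suspFlow {X : Type*} (T : X → X) (φ : X → ℝ) (t : ℝ) (p : Susp φ) : Susp φ :=
  if h : ∃ q, SuspReaches T φ t p q then h.choose else p

/-- The normalization `ν_μ` of the measure `μ ⊗ Leb` on the suspension space. -/
def suspMeasure {X : Type*} [MeasurableSpace X] (μ : Measure X) (φ : X → ℝ) :
    Measure (Susp φ) :=
  (((μ.prod volume).comap (Subtype.val : Susp φ → X × ℝ)) univ)⁻¹ •
    (μ.prod volume).comap (Subtype.val : Susp φ → X × ℝ)

/-! ### The Bowen-Walters distance -/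

/-- `BWChain T p q ℓ`: in the suspension space with constant height `1`, there is a finite path
of total length `ℓ` from `p` to `q` consisting of horizontal segments, from `(x, t)` to `(y, t)` of
length `(1 - t) d(x, y) + t d(T x, T y)`, and of vertical segments, between two points of one orbit,
whose length is the time in which the flow leads from one of the two points to the other. -/
inductive BWChain {X : Type*} [PseudoMetricSpace X] (T : X → X) :
    Susp (fun _ : X => (1 : ℝ)) → Susp (fun _ : X => (1 : ℝ)) → ℝ → Prop
  | refl (p) : BWChain T p p 0
  | horizontal (p p' q) (l : ℝ) : p.1.2 = p'.1.2 → BWChain T p' q l →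
      BWChain T p q ((1 - p.1.2) * dist p.1.1 p'.1.1 + p.1.2 * dist (T p.1.1) (T p'.1.1) + l)
  | vertical (p p' q) (t l : ℝ) : 0 ≤ t →
      SuspReaches T (fun _ => 1) t p p' ∨ SuspReaches T (fun _ => 1) t p' p →
      BWChain T p' q l → BWChain T p q (t + l)

/-- The rescaling `(x, s) ↦ (x, s / φ x)` onto the suspension space with constant height `1`. -/
def Susp.normalize {X : Type*} {φ : X → ℝ} (p : Susp φ) : Susp (fun _ : X => (1 : ℝ)) :=
  ⟨(p.1.1, p.1.2 / φ p.1.1),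
    div_nonneg p.2.1 (p.2.1.trans p.2.2.le), (div_lt_one (p.2.1.trans_lt p.2.2)).2 p.2.2⟩

/-- The Bowen-Walters distance on the suspension space: the infimum of the lengths of the paths
between the rescaled points. -/
def bwDist {X : Type*} [PseudoMetricSpace X] (T : X → X) (φ : X → ℝ) (p q : Susp φ) : ℝ :=
  sInf {l : ℝ | BWChain T p.normalize q.normalize l}

/-- Any two points are joined by a path: down to the base, along the base, and up. -/
theorem exists_bwChain {X : Type*} [PseudoMetricSpace X] (T : X → X)
    (p q : Susp (fun _ : X => (1 : ℝ))) : ∃ l, BWChain T p q l := by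
  let p₀ : Susp (fun _ : X => (1 : ℝ)) := ⟨(p.1.1, 0), le_rfl, one_pos⟩
  let q₀ : Susp (fun _ : X => (1 : ℝ)) := ⟨(q.1.1, 0), le_rfl, one_pos⟩
  exact ⟨_, .vertical p p₀ q p.1.2 _ p.2.1 (Or.inr ⟨0, by simp [p₀], by simp [p₀]⟩)
    (.horizontal p₀ q₀ q _ rfl
      (.vertical q₀ q q q.1.2 0 q.2.1 (Or.inl ⟨0, by simp [q₀], by simp [q₀]⟩) (.refl q)))⟩

/-- Lengths of paths are nonnegative. -/
theorem BWChain.nonneg {X : Type*} [PseudoMetricSpace X] {T : X → X}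
    {p q : Susp (fun _ : X => (1 : ℝ))} {l : ℝ} (h : BWChain T p q l) : 0 ≤ l := by
  induction h with
  | refl p => exact le_rfl
  | horizontal p p' q l hp _ ih =>
      have h1 : 0 ≤ 1 - p.1.2 := sub_nonneg.2 p.2.2.le
      have h2 : 0 ≤ p.1.2 := p.2.1
      positivity
  | vertical p p' q t l ht _ _ ih => positivity

/-- Lipschitz functions on the suspension space with the Bowen-Walters distance. -/
def BWLipschitz {X E : Type*} [PseudoMetricSpace X] [PseudoMetricSpace E] (T : X → X) (φ : X → ℝ)
    (F : Susp φ → E) : Prop :=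
  ∃ K : ℝ≥0, ∀ p q : Susp φ, dist (F p) (F q) ≤ K * bwDist T φ p q

/-! ### Metric isomorphism, projection dimensions, decay of correlations -/

/-- `g` is a metric isomorphism between the suspension flow over `T` with height `φ` and measure
`ν_μ`, and the flow `Ψ` with measure `ν`: up to null sets, `g` is a bijection that intertwines the
two flows (for `t ≥ 0`) and transports the measures in both directions. -/
def IsMetricIsomorphism {X M : Type*} [MeasurableSpace X] [MeasurableSpace M]
    (T : X → X) (φ : X → ℝ) (μ : Measure X) (Ψ : ℝ → M → M) (ν : Measure M)
    (g : Susp φ → M) : Prop :=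
  ∃ (Y' : Set (Susp φ)) (M' : Set M), MeasurableSet Y' ∧ MeasurableSet M' ∧
    suspMeasure μ φ Y' = 1 ∧ ν M' = 1 ∧ BijOn g Y' M' ∧
    (∀ t : ℝ, 0 ≤ t → ∀ y ∈ Y', suspFlow T φ t y ∈ Y' ∧ g (suspFlow T φ t y) = Ψ t (g y)) ∧
    (∀ A : Set M, MeasurableSet A → ν A = suspMeasure μ φ (g ⁻¹' A)) ∧
    (∀ B : Set (Susp φ), B ⊆ Y' → MeasurableSet B → suspMeasure μ φ B = ν (g '' B))

/-- `liminf_{r → 0} log μ(π F⁻¹ B(z, r)) / log r`, for an observation `F` of the suspension. With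
`F = f ∘ g` and `z = f x` it is the lower local projection dimension at `x`. -/
def lowerProjDim {X E : Type*} [MeasurableSpace X] [PseudoMetricSpace E] (μ : Measure X)
    {φ : X → ℝ} (F : Susp φ → E) (z : E) : EReal :=
  liminf (fun r : ℝ => ENNReal.log (μ (Susp.proj '' (F ⁻¹' Metric.ball z r))) /
    ((Real.log r : ℝ) : EReal)) (𝓝[>] 0)

/-- `limsup_{r → 0} log μ(π F⁻¹ B(z, r)) / log r`: the upper local projection dimension. -/
def upperProjDim {X E : Type*} [MeasurableSpace X] [PseudoMetricSpace E] (μ : Measure X)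
    {φ : X → ℝ} (F : Susp φ → E) (z : E) : EReal :=
  limsup (fun r : ℝ => ENNReal.log (μ (Susp.proj '' (F ⁻¹' Metric.ball z r))) /
    ((Real.log r : ℝ) : EReal)) (𝓝[>] 0)

/-- Super-polynomial decay of correlations for (bounded) Lipschitz functions. The Lipschitz norm
is the supremum norm plus the least Lipschitz constant, so a bound by `‖u‖ ‖v‖ θ n` is a bound by
`(C + K) (D + L) θ n` for all `C, D` bounding `|u|, |v|` and all Lipschitz constants `K, L`. -/
def SuperPolynomialDecay {X : Type*} [PseudoMetricSpace X] [MeasurableSpace X] (T : X → X)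
    (μ : Measure X) : Prop :=
  ∃ θ : ℕ → ℝ, (∀ k : ℕ, Tendsto (fun n : ℕ => (n : ℝ) ^ k * θ n) atTop (𝓝 0)) ∧
    ∀ (u v : X → ℝ) (C D K L : ℝ≥0), (∀ x, |u x| ≤ C) → (∀ x, |v x| ≤ D) →
      LipschitzWith K u → LipschitzWith L v → ∀ n : ℕ, 1 ≤ n →
        |∫ x, u (T^[n] x) * v x ∂μ - (∫ x, u x ∂μ) * ∫ x, v x ∂μ| ≤ (C + K) * (D + L) * θ n

end

/-! A return of the flow is reduced to a visit of the base orbit to a shrinking target. If the flow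
brings `y`, lying over `u`, into `F ⁻¹' B(z, r)` with `z = F y`, and has by then crossed `n` fibres,
then `T^[n] u` lies in `π F⁻¹ B(z, r)`. This target is the sublevel set `{fibreDist z < r}`. At a
fixed relative height, `F` is Lipschitz in the base point, because the horizontal segments of the
Bowen-Walters distance are controlled by the Lipschitz constant of `T`; hence `fibreDist z` is
Lipschitz too, and decay of correlations applies.

The target depends on the starting point through `z`, so `z` is discretized on a grid of mesh `2 ^
(-m k)`. For one grid point and one time `n`, the correlation bound gives a product of two integrals
plus an error. The products sum well because the bumps around the grid points overlap boundedly; the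
errors sum well because `θ n` beats the number of grid points, the number of times and the squared
Lipschitz norms, all exponential in `k`, as soon as `n ≥ 2 ^ k`. With Borel-Cantelli
(`ae_eventually_not_shortReturn`), almost every orbit avoids its target during `[2 ^ k, 2 ^ (j k)]`
for all large `k` at which the target has measure at most a constant times `2 ^ (-(j + 1) k)`.
Fubini in the relative height carries this to the suspension.

Times below `2 ^ k` are covered by the windows of earlier scales, whose targets are larger. This
requires a power bound on the measure at all small scales, which is what positivity of the lower
dimension supplies, also for the upper inequality. Only boundedly many iterates remain, and a large
`p` excludes them (`exists_eventually_rpow_le_returnTime`). Finally, the number of crossed fibres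
bounds the elapsed time from below, because Birkhoff sums of a positive function grow at least
linearly almost everywhere (`ae_exists_mul_le_birkhoffSum`). -/

/-! ### Linear growth of the Birkhoff sums of a positive function -/

/-- The maximum of the Birkhoff sums of `h` of orders `0, …, n`. -/
def birkhoffMax {X : Type*} (T : X → X) (h : X → ℝ) : ℕ → X → ℝ
  | 0 => 0
  | n + 1 => fun x => max 0 (h x + birkhoffMax T h n (T x))

section birkhoffMax

variable {X : Type*} {T : X → X} {h : X → ℝ}

theorem birkhoffMax_nonneg (n : ℕ) (x : X) : 0 ≤ birkhoffMax T h n x := by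
  cases n with
  | zero => exact le_rfl
  | succ n => exact le_max_left _ _

theorem birkhoffMax_le_succ (n : ℕ) (x : X) :
    birkhoffMax T h n x ≤ birkhoffMax T h (n + 1) x := by
  induction n generalizing x with
  | zero => exact birkhoffMax_nonneg 1 x
  | succ n ih => exact max_le_max le_rfl (by linarith [ih (T x)])

theorem birkhoffSum_le_birkhoffMax (n : ℕ) (x : X) :
    birkhoffSum T h n x ≤ birkhoffMax T h n x := by
  induction n generalizing x with
  | zero => simp [birkhoffMax]
  | succ n ih =>
    rw [birkhoffSum_succ']
    exact le_max_of_le_right (by linarith [ih (T x)])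

variable [MeasurableSpace X] {μ : Measure X}

theorem measurable_birkhoffMax (hT : Measurable T) (hh : Measurable h) (n : ℕ) :
    Measurable (birkhoffMax T h n) := by
  induction n with
  | zero => exact measurable_const
  | succ n ih => exact measurable_const.max (hh.add (ih.comp hT))

theorem integrable_birkhoffMax (hT : MeasurePreserving T μ μ) (hh : Integrable h μ) (n : ℕ) :
    Integrable (birkhoffMax T h n) μ := by
  induction n with
  | zero => exact integrable_zero _ _ _
  | succ n ih =>
    exact (integrable_zero X ℝ μ).sup
      (hh.add ((hT.integrable_comp ih.aestronglyMeasurable).2 ih))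

/-- The maximal ergodic theorem. -/
theorem setIntegral_birkhoffMax_pos_nonneg (hT : MeasurePreserving T μ μ) (hm : Measurable h)
    (hh : Integrable h μ) (n : ℕ) : 0 ≤ ∫ x in {x | 0 < birkhoffMax T h n x}, h x ∂μ := by
  have hM := integrable_birkhoffMax hT hh n
  have hMT := (hT.integrable_comp hM.aestronglyMeasurable).2 hM
  simp only [Function.comp_def] at hMT
  have hms : MeasurableSet {x | 0 < birkhoffMax T h n x} :=
    measurableSet_lt measurable_const (measurable_birkhoffMax hT.measurable hm n)
  have h0 : ∫ x, (birkhoffMax T h n x - birkhoffMax T h n (T x)) ∂μ = 0 := by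
    rw [integral_sub hM hMT]
    have := integral_map hT.measurable.aemeasurable (f := birkhoffMax T h n)
      (by rw [hT.map_eq]; exact hM.aestronglyMeasurable)
    rw [hT.map_eq] at this
    rw [← this, sub_self]
  rw [← integral_indicator hms]
  -- Garsia's argument: the difference of the maximum and its translate by `T` has integral zero and
  -- lies below `h` where the maximum is positive, below `0` elsewhere.
  refine h0.symm.le.trans (integral_mono (hM.sub hMT) (hh.indicator hms) fun x => ?_)
  by_cases hx : 0 < birkhoffMax T h n x
  · rw [indicator_of_mem (by exact hx)]
    cases n with
    | zero => exact absurd hx (lt_irrefl _)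
    | succ n =>
      have h1 : birkhoffMax T h (n + 1) x = h x + birkhoffMax T h n (T x) := by
        rcases max_choice 0 (h x + birkhoffMax T h n (T x)) with h2 | h2
        · exact absurd (show birkhoffMax T h (n + 1) x = 0 from h2) hx.ne'
        · exact h2
      have := birkhoffMax_le_succ (T := T) (h := h) n (T x)
      dsimp only
      linarith
  · rw [indicator_of_notMem (by exact hx)]
    have := birkhoffMax_nonneg (T := T) (h := h) n (T x)
    dsimp only
    linarith

/-- Without ergodicity the slope depends on the point. On the exceptional set `U`, for every `c > 0`
some Birkhoff sum of `c - φ` is positive, so the maximal ergodic theorem gives `∫_U φ ≤ c`. Hence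
`∫_U φ = 0`, and `U` is null since `φ > 0`. -/
theorem ae_exists_mul_le_birkhoffSum [IsProbabilityMeasure μ] (hT : MeasurePreserving T μ μ)
    {φ : X → ℝ} (hpos : ∀ x, 0 < φ x) (hm : Measurable φ) (hi : Integrable φ μ) :
    ∀ᵐ x ∂μ, ∃ c : ℝ, 0 < c ∧ ∀ n : ℕ, c * n ≤ birkhoffSum T φ n x := by
  set U := {x | ¬ ∃ c : ℝ, 0 < c ∧ ∀ n : ℕ, c * n ≤ birkhoffSum T φ n x} with hU
  have key : ∀ c : ℝ, 0 < c → ∫⁻ x in U, ENNReal.ofReal (φ x) ∂μ ≤ ENNReal.ofReal c := by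
    intro c hc
    set h : X → ℝ := fun x => c - φ x with hh
    have hhm : Measurable h := measurable_const.sub hm
    have hhi : Integrable h μ := (integrable_const c).sub hi
    set D : ℕ → Set X := fun n => {x | 0 < birkhoffMax T h n x} with hD
    have hDm : ∀ n, MeasurableSet (D n) := fun n =>
      measurableSet_lt measurable_const (measurable_birkhoffMax hT.measurable hhm n)
    have hmono : Monotone D := monotone_nat_of_le_succ fun n x hx =>
      lt_of_lt_of_le (show 0 < birkhoffMax T h n x from hx) (birkhoffMax_le_succ n x)
    have hsub : U ⊆ ⋃ n, D n := by
      intro x hx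
      simp only [hU, mem_ofPred_eq, not_exists, not_and, not_forall, not_le] at hx
      obtain ⟨n, hn⟩ := hx c hc
      refine mem_iUnion.2 ⟨n, lt_of_lt_of_le ?_ (birkhoffSum_le_birkhoffMax n x)⟩
      have : birkhoffSum T h n x = c * n - birkhoffSum T φ n x := by
        simp [birkhoffSum, hh, Finset.sum_sub_distrib, mul_comm]
      linarith
    refine (lintegral_mono_set hsub).trans ?_
    rw [setLIntegral_iUnion_of_directed _ hmono.directed_le]
    refine iSup_le fun n => ?_
    rw [← ofReal_integral_eq_lintegral_ofReal hi.integrableOn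
      (Eventually.of_forall fun x => (hpos x).le)]
    refine ENNReal.ofReal_le_ofReal ?_
    have h1 := setIntegral_birkhoffMax_pos_nonneg hT hhm hhi n
    rw [integral_sub (integrable_const c) hi.integrableOn, setIntegral_const, smul_eq_mul] at h1
    have h2 : μ.real (D n) ≤ 1 := measureReal_le_one
    have h3 : μ.real (D n) * c ≤ c := by nlinarith
    exact (sub_nonneg.1 h1).trans h3
  have h0 : ∫⁻ x in U, ENNReal.ofReal (φ x) ∂μ = 0 := by
    refine le_antisymm (ENNReal.le_of_forall_pos_le_add fun ε hε _ => ?_) zero_le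
    rw [zero_add]
    simpa using key ε hε
  rw [lintegral_eq_zero_iff hm.ennreal_ofReal] at h0
  have h1 : ∀ᵐ x ∂(μ.restrict U), False := by
    filter_upwards [h0] with x hx
    simp only [Pi.zero_apply, ENNReal.ofReal_eq_zero] at hx
    exact absurd (hpos x) (not_lt.2 hx)
  have h2 : μ U = 0 := by simpa [ae_iff] using h1
  exact ae_iff.2 h2

end birkhoffMax

/-! ### Short returns are rare -/

/-- A `1`-Lipschitz cutoff function: `1` on `s ≤ c - 1` and `0` on `c ≤ s`. -/
def plateau (c s : ℝ) : ℝ := max 0 (min 1 (c - s))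

theorem plateau_nonneg (c s : ℝ) : 0 ≤ plateau c s := le_max_left _ _

theorem plateau_le_one (c s : ℝ) : plateau c s ≤ 1 := max_le zero_le_one (min_le_left _ _)

theorem one_le_plateau {c s : ℝ} (h : s ≤ c - 1) : 1 ≤ plateau c s :=
  le_max_of_le_right (le_min le_rfl (by linarith))

theorem plateau_eq_zero {c s : ℝ} (h : c ≤ s) : plateau c s = 0 :=
  max_eq_left (min_le_of_right_le (by linarith))

theorem lipschitzWith_plateau (c : ℝ) : LipschitzWith 1 (plateau c) := by
  have : LipschitzWith 1 fun s : ℝ => c - s :=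
    LipschitzWith.of_dist_le_mul fun x y => by rw [dist_sub_left]; simp
  exact (this.const_min 1).const_max 0

theorem lipschitzWith_const_mul {X : Type*} [PseudoMetricSpace X] {K : ℝ≥0} {f : X → ℝ}
    (hf : LipschitzWith K f) (a : ℝ≥0) : LipschitzWith (a * K) fun x => a * f x :=
  LipschitzWith.of_dist_le_mul fun x y => by
    have := mul_le_mul_of_nonneg_left (hf.dist_le_mul x y) a.2
    simp only [Real.dist_eq, ← mul_sub, abs_mul, NNReal.abs_eq, NNReal.coe_mul] at this ⊢
    rw [mul_assoc]
    exact this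

/-- A bump around the integer point `i`, in the coordinates `h z`. -/
def gridBump {N : ℕ} (h : ℝ) (i : Fin N → ℤ) (z : Fin N → ℝ) : ℝ :=
  plateau 2 (dist (h • z) (fun j => (i j : ℝ)))

theorem lipschitzWith_gridBump {N : ℕ} (h : ℝ≥0) (i : Fin N → ℤ) :
    LipschitzWith h (gridBump (h : ℝ) i) := by
  have h1 : LipschitzWith h fun z : Fin N → ℝ => (h : ℝ) • z :=
    LipschitzWith.of_dist_le_mul fun x y => by rw [dist_smul₀]; simp
  have h2 := (lipschitzWith_plateau 2).comp
    ((LipschitzWith.dist_left fun j => (i j : ℝ)).comp h1)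
  rw [one_mul, one_mul] at h2
  exact h2

/-- Bounded overlap: a bump is nonzero at `z` only if every `i j` is within distance `2` of `h * z
j`, which leaves at most four integers per coordinate. The bound depends neither on the scale nor on
the number of bumps. -/
theorem sum_gridBump_le {N : ℕ} (h : ℝ) (s : Finset (Fin N → ℤ)) (z : Fin N → ℝ) :
    ∑ i ∈ s, gridBump h i z ≤ 4 ^ N := by
  classical
  set t := Fintype.piFinset fun j : Fin N => Finset.Icc (⌊h * z j⌋ - 1) (⌊h * z j⌋ + 2) with ht
  have hcard : t.card = 4 ^ N := by
    rw [ht, Fintype.card_piFinset]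
    simp only [Int.card_Icc]
    have : ∀ a : ℤ, (a + 2 + 1 - (a - 1)).toNat = 4 := fun a => by
      rw [show a + 2 + 1 - (a - 1) = 4 by ring]; rfl
    simp [this]
  calc ∑ i ∈ s, gridBump h i z ≤ ∑ i ∈ s ∪ t, gridBump h i z :=
        Finset.sum_le_sum_of_subset_of_nonneg Finset.subset_union_left
          fun i _ _ => plateau_nonneg _ _
    _ = ∑ i ∈ t, gridBump h i z := by
        symm
        refine Finset.sum_subset Finset.subset_union_right fun i _ hi => plateau_eq_zero ?_
        by_contra! hlt
        refine hi (Fintype.mem_piFinset.2 fun j => ?_)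
        have h1 := (dist_le_pi_dist (h • z) (fun j => (i j : ℝ)) j).trans_lt hlt
        rw [Real.dist_eq, abs_lt, Pi.smul_apply, smul_eq_mul] at h1
        have h2 := Int.floor_le (h * z j)
        have h3 := Int.lt_floor_add_one (h * z j)
        rw [Finset.mem_Icc]
        constructor
        · have : ((⌊h * z j⌋ : ℤ) : ℝ) < ((i j + 2 : ℤ) : ℝ) := by push_cast; linarith
          have := Int.cast_lt.1 this
          omega
        · have : ((i j : ℤ) : ℝ) < ((⌊h * z j⌋ + 3 : ℤ) : ℝ) := by push_cast; linarith
          have := Int.cast_lt.1 this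
          omega
    _ ≤ ∑ i ∈ t, (1 : ℝ) := Finset.sum_le_sum fun i _ => plateau_le_one _ _
    _ = 4 ^ N := by simp [hcard]

theorem integrable_of_mem_Icc {X : Type*} [MeasurableSpace X] {μ : Measure X} [IsFiniteMeasure μ]
    {v : X → ℝ} (hv : Measurable v) (hv0 : ∀ x, 0 ≤ v x) (hv1 : ∀ x, v x ≤ 1) : Integrable v μ :=
  Integrable.of_bound hv.aestronglyMeasurable 1
    (Eventually.of_forall fun x => by rw [Real.norm_of_nonneg (hv0 x)]; exact hv1 x)

theorem measureReal_le_integral {X : Type*} [MeasurableSpace X] {μ : Measure X} [IsFiniteMeasure μ]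
    {v : X → ℝ} (hv : Measurable v) (hv0 : ∀ x, 0 ≤ v x)
    (hv1 : ∀ x, v x ≤ 1) : μ.real {x | 1 ≤ v x} ≤ ∫ x, v x ∂μ := by
  have hm : MeasurableSet {x | 1 ≤ v x} := measurableSet_le measurable_const hv
  rw [← integral_indicator_one hm]
  refine integral_mono ((integrable_const (1 : ℝ)).indicator hm)
    (integrable_of_mem_Icc hv hv0 hv1) fun x => ?_
  by_cases hx : 1 ≤ v x
  · rw [indicator_of_mem (by exact hx)]; exact hx
  · rw [indicator_of_notMem (by exact hx)]; exact hv0 x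

theorem integral_le_measureReal {X : Type*} [MeasurableSpace X] {μ : Measure X} [IsFiniteMeasure μ]
    {v : X → ℝ} (hv : Measurable v) (hv0 : ∀ x, 0 ≤ v x)
    (hv1 : ∀ x, v x ≤ 1) {s : Set X} (hs : MeasurableSet s) (h : ∀ x ∉ s, v x = 0) :
    ∫ x, v x ∂μ ≤ μ.real s := by
  rw [← integral_indicator_one hs]
  refine integral_mono (integrable_of_mem_Icc hv hv0 hv1)
    ((integrable_const (1 : ℝ)).indicator hs) fun x => ?_
  by_cases hx : x ∈ s
  · rw [indicator_of_mem hx]; exact hv1 x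
  · rw [indicator_of_notMem hx, h x hx]

section ShortReturns

variable {X : Type*} [PseudoMetricSpace X] [MeasurableSpace X] [OpensMeasurableSpace X]
  {μ : Measure X} [IsProbabilityMeasure μ] {T : X → X}

theorem measureReal_correlation_le (hT : Measurable T) {v w : X → ℝ} {a b : ℝ≥0} {n : ℕ} {ε : ℝ}
    (hdecay : ∀ (u v : X → ℝ) (C D K L : ℝ≥0), (∀ x, |u x| ≤ C) → (∀ x, |v x| ≤ D) →
      LipschitzWith K u → LipschitzWith L v →
        |∫ x, u (T^[n] x) * v x ∂μ - (∫ x, u x ∂μ) * ∫ x, v x ∂μ| ≤ (C + K) * (D + L) * ε)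
    (hv : LipschitzWith a v) (hw : LipschitzWith b w) (hv0 : ∀ x, 0 ≤ v x) (hv1 : ∀ x, v x ≤ 1)
    (hw0 : ∀ x, 0 ≤ w x) (hw1 : ∀ x, w x ≤ 1) :
    μ.real {x | 1 ≤ v x ∧ 1 ≤ w (T^[n] x)} ≤
      (∫ x, v x ∂μ) * ∫ x, w x ∂μ + (1 + b) * (1 + a) * ε := by
  have hvm := hv.continuous.measurable
  have hwm : Measurable fun x => w (T^[n] x) := hw.continuous.measurable.comp (hT.iterate n)
  have h1 : μ.real {x | 1 ≤ v x ∧ 1 ≤ w (T^[n] x)} ≤ ∫ x, w (T^[n] x) * v x ∂μ := by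
    refine le_trans (measureReal_mono fun x hx => ?_)
      (measureReal_le_integral (hwm.mul hvm) (fun x => mul_nonneg (hw0 _) (hv0 x))
        fun x => mul_le_one₀ (hw1 _) (hv0 x) (hv1 x))
    exact one_le_mul_of_one_le_of_one_le hx.2 hx.1
  have h2 := hdecay w v 1 1 b a (fun x => by rw [abs_of_nonneg (hw0 x)]; exact hw1 x)
    (fun x => by rw [abs_of_nonneg (hv0 x)]; exact hv1 x) hw hv
  have h3 := (abs_le.1 h2).2
  rw [mul_comm (∫ x, v x ∂μ)]
  push_cast at h3
  linarith

/-- The points of the grid of mesh `2 ^ (-m k)`. -/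
noncomputable def gridPoint {N : ℕ} (m k : ℕ) (i : Fin N → ℤ) : Fin N → ℝ := fun j => (1 / 2) ^ (m * k) * i j

/-- The indices of the points of the grid of mesh `2 ^ (-m k)` in the cube of radius `R`. -/
noncomputable def gridIndices (N m R k : ℕ) : Finset (Fin N → ℤ) :=
  Fintype.piFinset fun _ => Finset.Icc (-(R * 2 ^ (m * k) : ℤ)) (R * 2 ^ (m * k))

theorem card_gridIndices_le (N m R k : ℕ) :
    ((gridIndices N m R k).card : ℝ) ≤ (2 * R + 1) ^ N * 2 ^ (m * k * N) := by
  have h1 : (gridIndices N m R k).card = (2 * R * 2 ^ (m * k) + 1) ^ N := by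
    rw [gridIndices, Fintype.card_piFinset]
    simp only [Int.card_Icc, Finset.prod_const, Finset.card_univ, Fintype.card_fin]
    congr 1
    zify
    have : (0 : ℤ) ≤ R * 2 ^ (m * k) := by positivity
    rw [Int.toNat_of_nonneg (by linarith)]
    ring
  rw [h1, pow_mul 2 (m * k) N, ← mul_pow]
  push_cast
  have h2 : (1 : ℝ) ≤ 2 ^ (m * k) := one_le_pow₀ one_le_two
  gcongr
  nlinarith

/-- Up to the discretization at mesh `2 ^ (-m k)`, the orbit of `x` enters the `2 ^ (-m k)`-sublevel
set of `ψ z` at a time in `[2 ^ k, 2 ^ (j k)]`, while that set has measure at most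
`c 2 ^ (-(j + 1) k)`. -/
def ShortReturn {N : ℕ} (μ : Measure X) (T : X → X) (ψ : (Fin N → ℝ) → X → ℝ) (ρ c : ℝ)
    (m j R k : ℕ) (z : Fin N → ℝ) (x : X) : Prop :=
  ∃ i ∈ gridIndices N m R k,
    μ.real {x' | 2 ^ (m * k) * ψ (gridPoint m k i) x' < ρ} ≤ c * (1 / 2) ^ ((j + 1) * k) ∧
    ∃ n ∈ Finset.Icc (2 ^ k) (2 ^ (j * k)), 1 ≤ gridBump (2 ^ (m * k)) i z ∧
      1 ≤ plateau ρ (2 ^ (m * k) * ψ (gridPoint m k i) (T^[n] x))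

omit [PseudoMetricSpace X] [OpensMeasurableSpace X] [IsProbabilityMeasure μ] in
theorem measurableSet_shortReturn (hT : Measurable T) {N : ℕ} {ψ : (Fin N → ℝ) → X → ℝ}
    (hψ : ∀ z, Measurable (ψ z)) {Y : Type*} [MeasurableSpace Y] {q : Y → Fin N → ℝ}
    (hq : Measurable q) {p : Y → X} (hp : Measurable p) {ρ c : ℝ} {m j R k : ℕ} :
    MeasurableSet {y | ShortReturn μ T ψ ρ c m j R k (q y) (p y)} := by
  have h1 : ∀ i, Measurable fun y => 1 ≤ gridBump (2 ^ (m * k)) i (q y) := fun i =>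
    measurableSet_setOfPred.1 <| measurableSet_le measurable_const <|
      (lipschitzWith_plateau 2).continuous.measurable.comp
        ((hq.const_smul ((2 : ℝ) ^ (m * k))).dist measurable_const)
  have h2 : ∀ i n, Measurable fun y =>
      1 ≤ plateau ρ (2 ^ (m * k) * ψ (gridPoint m k i) (T^[n] (p y))) := fun i n =>
    measurableSet_setOfPred.1 <| measurableSet_le measurable_const <|
      (lipschitzWith_plateau ρ).continuous.measurable.comp
        (((hψ _).comp ((hT.iterate n).comp hp)).const_mul _)
  exact measurableSet_setOfPred.2 <| .exists fun i => .and measurable_const <|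
    .and measurable_const <| .exists fun n => .and measurable_const <| .and (h1 i) (h2 i n)

/-- A union bound over grid points and times. In the product terms, bounded overlap makes the sum
over the grid cost only `4 ^ N`, so `2 ^ (j k)` times against measure `2 ^ (-(j + 1) k)` leave a
factor `2 ^ (-k)`. The correlation errors are absorbed by the decay. -/
theorem exists_measureReal_shortReturn_le (hT : Measurable T) (hdecay : SuperPolynomialDecay T μ)
    {N : ℕ} {K : ℝ≥0} {ψ : (Fin N → ℝ) → X → ℝ} (hψ : ∀ z, LipschitzWith K (ψ z))
    {q : X → Fin N → ℝ} (hq : LipschitzWith K q) (ρ : ℝ) {c : ℝ} (hc : 0 ≤ c) (m j R : ℕ) :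
    ∃ C : ℝ, ∀ k, μ.real {x | ShortReturn μ T ψ ρ c m j R k (q x) x} ≤ C * (1 / 2) ^ k := by
  classical
  obtain ⟨θ, hθ, hdecay⟩ := hdecay
  -- The exponent pays for the grid points (`m * N`), the times (`j`) and the two Lipschitz norms
  -- (`2 * m`); the last `1` yields the factor `2 ^ (-k)`.
  set Q := m * N + j + 2 * m + 1 with hQ
  obtain ⟨A₀, hA₀⟩ := (hθ Q).bddAbove_range
  obtain ⟨A, hA, hA0⟩ : ∃ A : ℝ, (∀ n : ℕ, (n : ℝ) ^ Q * θ n ≤ A) ∧ 0 ≤ A :=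
    ⟨max A₀ 0, fun n => (hA₀ ⟨n, rfl⟩).trans (le_max_left _ _), le_max_right _ _⟩
  refine ⟨4 ^ N * c + (2 * R + 1) ^ N * (1 + K) ^ 2 * A, fun k => ?_⟩
  set h : ℝ≥0 := 2 ^ (m * k) with hh
  have hcoe : ((h : ℝ≥0) : ℝ) = 2 ^ (m * k) := by simp [hh]
  have hone : (1 : ℝ) ≤ 2 ^ (m * k) := one_le_pow₀ one_le_two
  set v : (Fin N → ℤ) → X → ℝ := fun i x => gridBump h i (q x) with hv
  set w : (Fin N → ℤ) → X → ℝ := fun i x => plateau ρ (h * ψ (gridPoint m k i) x) with hw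
  set S : (Fin N → ℤ) → Set X :=
    fun i => {x' | 2 ^ (m * k) * ψ (gridPoint m k i) x' < ρ} with hS
  have hvL : ∀ i, LipschitzWith (h * K) (v i) := fun i => (lipschitzWith_gridBump h i).comp hq
  have hwL : ∀ i, LipschitzWith (h * K) (w i) := fun i => by
    have := (lipschitzWith_plateau ρ).comp (lipschitzWith_const_mul (hψ (gridPoint m k i)) h)
    rw [one_mul] at this
    exact this
  have hv0 : ∀ i x, 0 ≤ v i x := fun i x => plateau_nonneg _ _
  have hv1 : ∀ i x, v i x ≤ 1 := fun i x => plateau_le_one _ _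
  have hw0 : ∀ i x, 0 ≤ w i x := fun i x => plateau_nonneg _ _
  have hw1 : ∀ i x, w i x ≤ 1 := fun i x => plateau_le_one _ _
  have hvi : ∀ i, Integrable (v i) μ := fun i =>
    integrable_of_mem_Icc (hvL i).continuous.measurable (hv0 i) (hv1 i)
  have hwS : ∀ i, ∫ x, w i x ∂μ ≤ μ.real (S i) := fun i =>
    integral_le_measureReal (hwL i).continuous.measurable (hw0 i) (hw1 i)
      (measurableSet_lt ((hψ _).continuous.measurable.const_mul _) measurable_const)
      fun x hx => plateau_eq_zero (by rw [hcoe]; exact not_lt.1 hx)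
  set I := (gridIndices N m R k).filter
    fun i => μ.real (S i) ≤ c * (1 / 2) ^ ((j + 1) * k) with hI
  set J := Finset.Icc (2 ^ k) (2 ^ (j * k)) with hJ
  have hJcard : (J.card : ℝ) ≤ 2 ^ (j * k) := by
    have : J.card ≤ 2 ^ (j * k) := by
      rw [hJ, Nat.card_Icc]
      have := Nat.one_le_two_pow (n := k)
      have := Nat.one_le_two_pow (n := j * k)
      omega
    exact_mod_cast this
  have hIcard : (I.card : ℝ) ≤ (2 * R + 1) ^ N * 2 ^ (m * k * N) :=
    (Nat.cast_le.2 (Finset.card_filter_le _ _)).trans (card_gridIndices_le N m R k)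
  have hset : {x | ShortReturn μ T ψ ρ c m j R k (q x) x} ⊆
      ⋃ i ∈ I, ⋃ n ∈ J, {x | 1 ≤ v i x ∧ 1 ≤ w i (T^[n] x)} := by
    rintro x ⟨i, hi, hi', n, hn, h1, h2⟩
    refine mem_biUnion (x := i) (Finset.mem_filter.2 ⟨hi, hi'⟩) (mem_biUnion (x := n) hn ⟨?_, ?_⟩)
    · simpa only [hv, hcoe] using h1
    · simpa only [hw, hcoe] using h2
  have hterm : ∀ i ∈ I, ∀ n ∈ J, μ.real {x | 1 ≤ v i x ∧ 1 ≤ w i (T^[n] x)} ≤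
      (∫ x, v i x ∂μ) * (c * (1 / 2) ^ ((j + 1) * k)) +
        (1 + K) ^ 2 * 2 ^ (2 * (m * k)) * (A * (1 / 2) ^ (Q * k)) := by
    intro i hi n hn
    have hn1 : 2 ^ k ≤ n := (Finset.mem_Icc.1 hn).1
    have hn0 : 1 ≤ n := Nat.one_le_two_pow.trans hn1
    refine (measureReal_correlation_le hT (ε := A * (1 / 2) ^ (Q * k)) (fun u v C D K L h1 h2 h3 h4 =>
      (hdecay u v C D K L h1 h2 h3 h4 n hn0).trans ?_)
      (hvL i) (hwL i) (hv0 i) (hv1 i) (hw0 i) (hw1 i)).trans (add_le_add ?_ ?_)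
    · have h5 : (1 : ℝ) ≤ (n : ℝ) ^ Q * (1 / 2) ^ (Q * k) := by
        rw [mul_comm Q k, pow_mul, ← mul_pow]
        refine one_le_pow₀ ?_
        have : (2 : ℝ) ^ k ≤ n := by exact_mod_cast hn1
        calc (1 : ℝ) = 2 ^ k * (1 / 2) ^ k := by rw [← mul_pow]; norm_num
          _ ≤ n * (1 / 2) ^ k := by gcongr
      have h6 := hA n
      -- The sign of `θ n` is not prescribed; `A` was made nonnegative to cover negative values.
      have h7 : θ n ≤ A * (1 / 2) ^ (Q * k) := by
        by_cases hneg : θ n ≤ 0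
        · exact hneg.trans (by positivity)
        · push Not at hneg
          calc θ n ≤ ((n : ℝ) ^ Q * (1 / 2) ^ (Q * k)) * θ n :=
                le_mul_of_one_le_left hneg.le h5
            _ = ((n : ℝ) ^ Q * θ n) * (1 / 2) ^ (Q * k) := by ring
            _ ≤ A * (1 / 2) ^ (Q * k) := by gcongr
      gcongr
    · exact mul_le_mul_of_nonneg_left ((hwS i).trans (Finset.mem_filter.1 hi).2)
        (integral_nonneg (hv0 i))
    · have h8 : (1 : ℝ) + (h * K : ℝ≥0) ≤ (1 + K) * 2 ^ (m * k) := by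
        push_cast
        rw [hcoe]
        have := K.2
        nlinarith
      have h9 : (1 + ((h * K : ℝ≥0) : ℝ)) * (1 + ((h * K : ℝ≥0) : ℝ)) ≤
          (1 + K) ^ 2 * 2 ^ (2 * (m * k)) := by
        calc _ ≤ ((1 + K) * 2 ^ (m * k)) * ((1 + K) * 2 ^ (m * k) : ℝ) := by gcongr
          _ = _ := by ring
      gcongr
  have hsum0 : 0 ≤ ∑ i ∈ I, ∫ x, v i x ∂μ :=
    Finset.sum_nonneg fun i _ => integral_nonneg (hv0 i)
  have hsum : ∑ i ∈ I, ∫ x, v i x ∂μ ≤ 4 ^ N := by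
    rw [← integral_finsetSum _ fun i _ => hvi i]
    calc ∫ x, ∑ i ∈ I, v i x ∂μ ≤ ∫ _, (4 : ℝ) ^ N ∂μ :=
          integral_mono (integrable_finsetSum _ fun i _ => hvi i) (integrable_const _)
            fun x => sum_gridBump_le _ _ _
      _ = 4 ^ N := by simp
  calc μ.real {x | ShortReturn μ T ψ ρ c m j R k (q x) x}
      ≤ μ.real (⋃ i ∈ I, ⋃ n ∈ J, {x | 1 ≤ v i x ∧ 1 ≤ w i (T^[n] x)}) :=
        measureReal_mono hset (measure_ne_top _ _)
    _ ≤ ∑ i ∈ I, ∑ n ∈ J, μ.real {x | 1 ≤ v i x ∧ 1 ≤ w i (T^[n] x)} :=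
        (measureReal_biUnion_finset_le _ _).trans
          (Finset.sum_le_sum fun i _ => measureReal_biUnion_finset_le _ _)
    _ ≤ ∑ i ∈ I, ∑ n ∈ J, ((∫ x, v i x ∂μ) * (c * (1 / 2) ^ ((j + 1) * k)) +
        (1 + K) ^ 2 * 2 ^ (2 * (m * k)) * (A * (1 / 2) ^ (Q * k))) :=
        Finset.sum_le_sum fun i hi => Finset.sum_le_sum fun n hn => hterm i hi n hn
    _ = J.card * ((∑ i ∈ I, ∫ x, v i x ∂μ) * (c * (1 / 2) ^ ((j + 1) * k))) +
        I.card * J.card * ((1 + K) ^ 2 * 2 ^ (2 * (m * k)) * (A * (1 / 2) ^ (Q * k))) := by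
        simp only [Finset.sum_const, nsmul_eq_mul, mul_add, Finset.sum_add_distrib,
          ← Finset.mul_sum, ← Finset.sum_mul]
        ring
    _ ≤ 2 ^ (j * k) * (4 ^ N * (c * (1 / 2) ^ ((j + 1) * k))) +
        ((2 * R + 1) ^ N * 2 ^ (m * k * N)) * 2 ^ (j * k) *
          ((1 + K) ^ 2 * 2 ^ (2 * (m * k)) * (A * (1 / 2) ^ (Q * k))) := by
        refine add_le_add (mul_le_mul hJcard (mul_le_mul_of_nonneg_right hsum (by positivity))
          (mul_nonneg hsum0 (by positivity)) (by positivity)) ?_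
        gcongr
    _ = (4 ^ N * c + (2 * R + 1) ^ N * (1 + K) ^ 2 * A) * (1 / 2) ^ k := by
        have e1 : (1 / 2 : ℝ) ^ ((j + 1) * k) = (1 / 2) ^ (j * k) * (1 / 2) ^ k := by ring
        have e2 : (1 / 2 : ℝ) ^ (Q * k) = (1 / 2) ^ (m * k * N) * (1 / 2) ^ (j * k) *
            (1 / 2) ^ (2 * (m * k)) * (1 / 2) ^ k := by rw [hQ]; ring
        have e3 : ∀ a : ℕ, (2 : ℝ) ^ a * (1 / 2) ^ a = 1 := fun a => by
          rw [← mul_pow]; norm_num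
        rw [e1, e2]
        linear_combination (4 ^ N * c * (1 / 2) ^ k) * e3 (j * k) +
          (2 * R + 1) ^ N * (1 + K) ^ 2 * A * (1 / 2) ^ k *
            (2 ^ (j * k) * (1 / 2) ^ (j * k) * 2 ^ (2 * (m * k)) * (1 / 2) ^ (2 * (m * k)) *
                e3 (m * k * N) +
              2 ^ (2 * (m * k)) * (1 / 2) ^ (2 * (m * k)) * e3 (j * k) + e3 (2 * (m * k)))

theorem ae_eventually_not_shortReturn (hT : Measurable T) (hdecay : SuperPolynomialDecay T μ)
    {N : ℕ} {K : ℝ≥0} {ψ : (Fin N → ℝ) → X → ℝ} (hψ : ∀ z, LipschitzWith K (ψ z))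
    {q : X → Fin N → ℝ} (hq : LipschitzWith K q) (ρ : ℝ) {c : ℝ} (hc : 0 ≤ c) (m j R : ℕ) :
    ∀ᵐ x ∂μ, ∀ᶠ k in atTop, ¬ ShortReturn μ T ψ ρ c m j R k (q x) x := by
  obtain ⟨C, hC⟩ := exists_measureReal_shortReturn_le hT hdecay hψ hq ρ hc m j R
  refine ae_eventually_notMem (s := fun k => {x | ShortReturn μ T ψ ρ c m j R k (q x) x}) ?_
  have hsummable : Summable fun k : ℕ => C * (1 / 2 : ℝ) ^ k :=
    (summable_geometric_of_lt_one (by norm_num) (by norm_num)).mul_left C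
  refine ne_top_of_le_ne_top hsummable.tsum_ofReal_ne_top (ENNReal.tsum_le_tsum fun k => ?_)
  rw [← ofReal_measureReal]
  exact ENNReal.ofReal_le_ofReal (hC k)

end ShortReturns

/-! ### Observations of the suspension -/

/-- The point of the fibre over `x` at the relative height `t`. -/
def Susp.atHeight {X : Type*} {φ : X → ℝ} (hφ : ∀ x, 0 < φ x) (t : Ico (0 : ℝ) 1) (x : X) :
    Susp φ :=
  ⟨(x, t * φ x), mul_nonneg t.2.1 (hφ x).le, mul_lt_of_lt_one_left (hφ x) t.2.2⟩

section Suspension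

variable {X : Type*} {φ : X → ℝ}

/-- The relative height of a point of the suspension. -/
noncomputable def Susp.height (p : Susp φ) : Ico (0 : ℝ) 1 :=
  ⟨p.normalize.1.2, p.normalize.2⟩

theorem Susp.atHeight_height (hφ : ∀ x, 0 < φ x) (p : Susp φ) :
    Susp.atHeight hφ p.height p.proj = p :=
  Subtype.ext (Prod.ext rfl (div_mul_cancel₀ _ (hφ _).ne'))

theorem Susp.normalize_atHeight (hφ : ∀ x, 0 < φ x) (t : Ico (0 : ℝ) 1) (x : X) :
    (Susp.atHeight hφ t x).normalize = ⟨(x, t), t.2⟩ :=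
  Subtype.ext (Prod.ext rfl (mul_div_cancel_right₀ _ (hφ x).ne'))

/-! ### Horizontal and vertical bounds for the Bowen-Walters distance -/

section Distance

variable [PseudoMetricSpace X] {T : X → X}

theorem bwDist_le {p q : Susp φ} {l : ℝ} (h : BWChain T p.normalize q.normalize l) :
    bwDist T φ p q ≤ l :=
  csInf_le ⟨0, fun _ h => h.nonneg⟩ h

theorem bwDist_atHeight_le {L : ℝ≥0} (hT : LipschitzWith L T) (hφ : ∀ x, 0 < φ x)
    (t : Ico (0 : ℝ) 1) (x y : X) :
    bwDist T φ (Susp.atHeight hφ t x) (Susp.atHeight hφ t y) ≤ (1 + L) * dist x y := by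
  have h := BWChain.horizontal (T := T) (Susp.atHeight hφ t x).normalize
    (Susp.atHeight hφ t y).normalize _ 0 (by simp only [Susp.normalize_atHeight]) (.refl _)
  refine (bwDist_le h).trans ?_
  simp only [Susp.normalize_atHeight, add_zero]
  have h0 := t.2.1
  have h1 := t.2.2
  have h2 := hT.dist_le_mul x y
  have h3 : 0 ≤ L * dist x y := by positivity
  have h4 : 0 ≤ t * dist x y := mul_nonneg h0 dist_nonneg
  nlinarith [mul_le_mul_of_nonneg_left h2 h0, mul_le_mul_of_nonneg_right h1.le h3]

theorem bwDist_atHeight_le_abs (hφ : ∀ x, 0 < φ x) (s t : Ico (0 : ℝ) 1) (x : X) :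
    bwDist T φ (Susp.atHeight hφ s x) (Susp.atHeight hφ t x) ≤ |(s : ℝ) - t| := by
  have h := BWChain.vertical (T := T) (Susp.atHeight hφ s x).normalize
    (Susp.atHeight hφ t x).normalize _ |(s : ℝ) - t| 0 (abs_nonneg _) ?_ (.refl _)
  · simpa using bwDist_le h
  · simp only [Susp.normalize_atHeight]
    rcases le_total (s : ℝ) t with hst | hst
    · exact Or.inl ⟨0, rfl, by rw [abs_of_nonpos (by linarith)]; simp⟩
    · exact Or.inr ⟨0, rfl, by rw [abs_of_nonneg (by linarith)]; simp⟩

end Distance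

/-! ### Regularity of a Lipschitz observation and of its distance to the fibres -/

section Observation

variable [PseudoMetricSpace X] {T : X → X} {E : Type*} [PseudoMetricSpace E] {F : Susp φ → E}

theorem BWLipschitz.exists_lipschitzWith (hF : BWLipschitz T φ F)
    (hT : ∃ L : ℝ≥0, LipschitzWith L T) (hφ : ∀ x, 0 < φ x) :
    ∃ K : ℝ≥0, ∀ t, LipschitzWith K fun x => F (Susp.atHeight hφ t x) := by
  obtain ⟨K, hK⟩ := hF
  obtain ⟨L, hL⟩ := hT
  refine ⟨K * (1 + L), fun t => LipschitzWith.of_dist_le_mul fun x y => (hK _ _).trans ?_⟩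
  have := mul_le_mul_of_nonneg_left (bwDist_atHeight_le hL hφ t x y) K.2
  push_cast
  rw [mul_assoc]
  exact this

theorem BWLipschitz.continuous_atHeight (hF : BWLipschitz T φ F) (hφ : ∀ x, 0 < φ x) (x : X) :
    Continuous fun t => F (Susp.atHeight hφ t x) := by
  obtain ⟨K, hK⟩ := hF
  refine (LipschitzWith.of_dist_le_mul (K := K) fun s t => (hK _ _).trans ?_).continuous
  exact mul_le_mul_of_nonneg_left (bwDist_atHeight_le_abs hφ s t x) K.2

/-- Continuity alone is not enough, since for nonseparable `X` the product σ-algebra may miss open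
sets. In the coordinates (relative height, base point), `F` is a Carathéodory function: continuous
in the first, measurable in the second. -/
theorem BWLipschitz.measurable [MeasurableSpace X] [OpensMeasurableSpace X] [MeasurableSpace E]
    [BorelSpace E] (hF : BWLipschitz T φ F) (hT : ∃ L : ℝ≥0, LipschitzWith L T)
    (hφ : ∀ x, 0 < φ x) (hφm : Measurable φ) : Measurable F := by
  obtain ⟨K, hK⟩ := hF.exists_lipschitzWith hT hφ
  have h1 := measurable_uncurry_of_continuous_of_measurable
    (u := fun (t : Ico (0 : ℝ) 1) (x : X) => F (Susp.atHeight hφ t x))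
    (fun x => hF.continuous_atHeight hφ x) (fun t => (hK t).continuous.measurable)
  have h2 : Measurable fun p : Susp φ => (p.height, p.proj) := by
    refine Measurable.prodMk (Measurable.subtype_mk ?_) (measurable_fst.comp measurable_subtype_coe)
    exact (measurable_snd.comp measurable_subtype_coe).div
      (hφm.comp (measurable_fst.comp measurable_subtype_coe))
  have h3 := h1.comp h2
  convert h3 using 1
  ext p
  exact congrArg F (Susp.atHeight_height hφ p).symm

/-- The distance from `z` to the set of values of `F` on the fibre over `x`. -/
noncomputable def fibreDist (hφ : ∀ x, 0 < φ x) (F : Susp φ → E) (z : E) (x : X) : ℝ :=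
  Metric.infDist z (range fun t => F (Susp.atHeight hφ t x))

omit [PseudoMetricSpace X] [PseudoMetricSpace E] in
theorem range_atHeight_nonempty (hφ : ∀ x, 0 < φ x) (x : X) :
    (range fun t => F (Susp.atHeight hφ t x)).Nonempty :=
  ⟨_, ⟨0, le_rfl, one_pos⟩, rfl⟩

omit [PseudoMetricSpace X] in
theorem fibreDist_lt_iff (hφ : ∀ x, 0 < φ x) {z : E} {x : X} {r : ℝ} :
    fibreDist hφ F z x < r ↔ x ∈ Susp.proj '' (F ⁻¹' Metric.ball z r) := by
  rw [fibreDist, Metric.infDist_lt_iff (range_atHeight_nonempty hφ _)]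
  simp only [mem_range, exists_exists_eq_and, mem_image, mem_preimage, Metric.mem_ball]
  constructor
  · rintro ⟨t, ht⟩
    exact ⟨_, by rwa [dist_comm], rfl⟩
  · rintro ⟨p, hp, rfl⟩
    exact ⟨p.height, by rwa [Susp.atHeight_height, dist_comm]⟩

omit [PseudoMetricSpace X] in
theorem fibreDist_le_add (hφ : ∀ x, 0 < φ x) (z w : E) (x : X) :
    fibreDist hφ F z x ≤ fibreDist hφ F w x + dist z w :=
  Metric.infDist_le_infDist_add_dist

/-- An infimum of `K`-Lipschitz functions of the base point, one for each relative height. -/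
theorem lipschitzWith_fibreDist (hφ : ∀ x, 0 < φ x) {K : ℝ≥0}
    (hK : ∀ t, LipschitzWith K fun x => F (Susp.atHeight hφ t x)) (z : E) :
    LipschitzWith K (fibreDist hφ F z) := by
  refine LipschitzWith.of_le_add_mul K fun x y => ?_
  refine le_of_forall_pos_lt_add fun ε hε => ?_
  obtain ⟨_, ⟨t, rfl⟩, ht⟩ := (Metric.infDist_lt_iff (range_atHeight_nonempty hφ _)).1
    (lt_add_of_pos_right (fibreDist hφ F z y) hε)
  have h1 : fibreDist hφ F z x ≤ dist z (F (Susp.atHeight hφ t x)) :=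
    Metric.infDist_le_dist_of_mem ⟨t, rfl⟩
  have h2 := dist_triangle z (F (Susp.atHeight hφ t y)) (F (Susp.atHeight hφ t x))
  have h3 := (hK t).dist_le_mul y x
  rw [dist_comm y x] at h3
  dsimp only at h3 ht
  linarith

end Observation

/-! ### Null sets of the suspension -/

section AlmostEverywhere

variable [MeasurableSpace X] {μ : Measure X}

theorem measurableSet_susp (hφm : Measurable φ) :
    MeasurableSet {p : X × ℝ | 0 ≤ p.2 ∧ p.2 < φ p.1} :=
  (measurableSet_le measurable_const measurable_snd).inter
    (measurableSet_lt measurable_snd (hφm.comp measurable_fst))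

/-- A measurable property that holds almost everywhere at each relative height holds almost
everywhere on the suspension. -/
theorem ae_suspMeasure_of_forall_atHeight [SFinite μ] (hφ : ∀ x, 0 < φ x) (hφm : Measurable φ)
    {P : Susp φ → Prop} (hPm : MeasurableSet {p | P p})
    (hP : ∀ t, ∀ᵐ x ∂μ, P (Susp.atHeight hφ t x)) : ∀ᵐ p ∂(suspMeasure μ φ), P p := by
  have hemb : MeasurableEmbedding (Subtype.val : Susp φ → X × ℝ) :=
    MeasurableEmbedding.subtype_coe (measurableSet_susp hφm)
  set A : Set (X × ℝ) := Subtype.val '' {p : Susp φ | P p}ᶜ with hA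
  have hAm : MeasurableSet A := hemb.measurableSet_image.2 hPm.compl
  suffices h : (μ.prod volume) A = 0 by
    rw [ae_iff, suspMeasure, Measure.smul_apply, smul_eq_mul]
    refine mul_eq_zero_of_right _ ?_
    rw [hemb.comap_apply]
    exact h
  -- Fubini is used twice in relative coordinates: horizontal slices show that the preimage of the
  -- bad set is null, so almost all of its vertical slices are null, and scaling by `φ x` preserves
  -- this.
  have hΘ : Measurable fun p : X × ℝ => (p.1, p.2 * φ p.1) :=
    measurable_fst.prodMk (measurable_snd.mul (hφm.comp measurable_fst))
  have hB : (μ.prod volume) ((fun p : X × ℝ => (p.1, p.2 * φ p.1)) ⁻¹' A) = 0 := by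
    rw [Measure.prod_apply_symm (hΘ hAm)]
    refine (lintegral_congr fun t => ?_).trans lintegral_zero
    by_cases ht : t ∈ Ico (0 : ℝ) 1
    · refine measure_mono_null (fun x hx => ?_) (ae_iff.1 (hP ⟨t, ht⟩))
      obtain ⟨p, hp, hpx⟩ := hx
      have : p = Susp.atHeight hφ ⟨t, ht⟩ x := Subtype.ext hpx
      change ¬ P _
      rw [← this]
      exact hp
    · refine measure_mono_null (t := ∅) (fun x hx => ht ?_) measure_empty
      obtain ⟨p, -, hpx⟩ := hx
      have h1 := p.2
      rw [hpx] at h1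
      exact ⟨nonneg_of_mul_nonneg_left h1.1 (hφ x), (mul_lt_iff_lt_one_left (hφ x)).1 h1.2⟩
  rw [Measure.measure_prod_null hAm]
  filter_upwards [(Measure.measure_prod_null (hΘ hAm)).1 hB] with x hx
  have h1 : volume ((fun t : ℝ => t * φ x) ⁻¹' (Prod.mk x ⁻¹' A)) = 0 := hx
  rw [Real.volume_preimage_mul_right (hφ x).ne'] at h1
  refine (mul_eq_zero.1 h1).resolve_left ?_
  simpa using (hφ x).ne'

theorem ae_suspMeasure_proj [SFinite μ] (hφ : ∀ x, 0 < φ x) (hφm : Measurable φ)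
    {P : X → Prop} (hP : ∀ᵐ x ∂μ, P x) : ∀ᵐ p ∂(suspMeasure μ φ), P p.proj := by
  obtain ⟨s, hs, hsm, hs0⟩ := exists_measurable_superset_of_null (ae_iff.1 hP)
  have h1 : ∀ᵐ p ∂(suspMeasure μ φ), p.proj ∉ s :=
    ae_suspMeasure_of_forall_atHeight hφ hφm
      ((measurable_fst.comp measurable_subtype_coe) hsm.compl)
      fun t => (measure_eq_zero_iff_ae_notMem.1 hs0 : ∀ᵐ x ∂μ, x ∉ s)
  filter_upwards [h1] with p hp
  by_contra hn
  exact hp (hs hn)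

end AlmostEverywhere

/-- With the relative height frozen, `F` becomes a Lipschitz function on the base and the
Borel-Cantelli estimate applies. All parameters are natural numbers, so one null set serves for all
of them. -/
theorem ae_eventually_not_shortReturn_susp [PseudoMetricSpace X] [MeasurableSpace X]
    [OpensMeasurableSpace X] {μ : Measure X} [IsProbabilityMeasure μ] {T : X → X}
    (hTm : Measurable T) (hTLip : ∃ L : ℝ≥0, LipschitzWith L T)
    (hdecay : SuperPolynomialDecay T μ) (hφ : ∀ x, 0 < φ x) (hφm : Measurable φ) {N : ℕ}
    {F : Susp φ → EuclideanSpace ℝ (Fin N)} (hF : BWLipschitz T φ F) :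
    ∀ᵐ y ∂(suspMeasure μ φ), ∀ ρ c m j R : ℕ, ∀ᶠ k in atTop,
      ¬ ShortReturn μ T (fun z => fibreDist hφ F (WithLp.toLp 2 z)) ρ c m j R k
        (WithLp.ofLp (F y)) y.proj := by
  obtain ⟨K, hK⟩ := hF.exists_lipschitzWith hTLip hφ
  have hFm := hF.measurable hTLip hφ hφm
  have hψ : ∀ z : Fin N → ℝ, LipschitzWith K (fibreDist hφ F (WithLp.toLp 2 z)) :=
    fun z => lipschitzWith_fibreDist hφ hK _
  simp only [ae_all_iff]
  intro ρ c m j R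
  refine ae_suspMeasure_of_forall_atHeight hφ hφm ?_ fun t => ?_
  · have hq : Measurable fun y : Susp φ => (WithLp.ofLp (F y) : Fin N → ℝ) :=
      (PiLp.continuous_ofLp 2 _).measurable.comp hFm
    have hproj : Measurable fun y : Susp φ => y.proj := measurable_fst.comp measurable_subtype_coe
    simp only [eventually_atTop, ofPred_exists, ofPred_forall]
    exact MeasurableSet.iUnion fun k₀ => MeasurableSet.iInter fun k => MeasurableSet.iInter fun _ =>
      (measurableSet_shortReturn hTm (fun z => (hψ z).continuous.measurable) hq hproj).compl
  · have h1 : LipschitzWith K fun x => (WithLp.ofLp (F (Susp.atHeight hφ t x)) : Fin N → ℝ) := by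
      have := (PiLp.lipschitzWith_ofLp 2 fun _ : Fin N => ℝ).comp (hK t)
      rwa [one_mul] at this
    exact ae_eventually_not_shortReturn hTm hdecay hψ h1 ρ (Nat.cast_nonneg c) m j R

end Suspension

/-! ### From the orbit of the base point to the return times of the flow -/

theorem EuclideanSpace.exists_dist_toLp_le (N : ℕ) :
    ∃ D : ℕ, ∀ a b : Fin N → ℝ, dist (WithLp.toLp 2 a) (WithLp.toLp 2 b) ≤ D * dist a b := by
  obtain ⟨D, hD⟩ := exists_nat_ge
    (((Fintype.card (Fin N) : ℝ≥0) ^ (1 / (2 : ℝ≥0∞)).toReal : ℝ≥0) : ℝ)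
  refine ⟨D, fun a b => ?_⟩
  have h := (PiLp.antilipschitzWith_ofLp 2 fun _ : Fin N => ℝ).le_mul_dist
    (WithLp.toLp 2 a) (WithLp.toLp 2 b)
  exact h.trans (mul_le_mul_of_nonneg_right hD dist_nonneg)

section Deduction

variable {X : Type*} [MeasurableSpace X] {μ : Measure X} {T : X → X} {φ : X → ℝ}

/-- Removes the grid: `z` is replaced by a nearby grid point, at the price of enlarging by the
factor `C` the radius at which the measure is tested. -/
theorem exists_forall_eventually_le_fibreDist [IsProbabilityMeasure μ] (hφ : ∀ x, 0 < φ x) {N : ℕ}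
    (F : Susp φ → EuclideanSpace ℝ (Fin N)) :
    ∃ C : ℕ, 0 < C ∧ ∀ (z : EuclideanSpace ℝ (Fin N)) (u : X),
      (∀ ρ c m j R : ℕ, ∀ᶠ k in atTop,
        ¬ ShortReturn μ T (fun z => fibreDist hφ F (WithLp.toLp 2 z)) ρ c m j R k
          (WithLp.ofLp z) u) →
      ∀ c m j : ℕ, ∀ᶠ k in atTop,
        μ.real {x | fibreDist hφ F z x < C * (1 / 2) ^ (m * k)} ≤ c * (1 / 2) ^ ((j + 1) * k) →
          ∀ n, 2 ^ k ≤ n → n ≤ 2 ^ (j * k) → (1 / 2) ^ (m * k) ≤ fibreDist hφ F z (T^[n] u) := by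
  obtain ⟨D, hD⟩ := EuclideanSpace.exists_dist_toLp_le N
  -- The grid point is within `D * r` of `z`. A visit at distance below `r` from `z` is within `(D +
  -- 1) * r` of it, so the cutoff is `ρ = D + 2`; returning to `z` adds another `D`.
  refine ⟨2 * D + 2, by omega, fun z u h c m j => ?_⟩
  obtain ⟨R, hR⟩ := exists_nat_ge ‖WithLp.ofLp z‖
  filter_upwards [h (D + 2) c m j R] with k hk hμ n hn1 hn2
  by_contra! hlt
  set r : ℝ := (1 / 2) ^ (m * k) with hr
  have hr0 : 0 < r := by positivity
  have hhr : (2 : ℝ) ^ (m * k) * r = 1 := by rw [hr, ← mul_pow]; norm_num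
  set H : ℝ := 2 ^ (m * k) with hH
  have hH0 : 0 < H := by positivity
  set i : Fin N → ℤ := fun l => ⌊H * z l⌋ with hi
  have hfloor : ∀ l, |H * z l - i l| ≤ 1 := fun l => by
    have h1 := Int.floor_le (H * z l)
    have h2 := Int.lt_floor_add_one (H * z l)
    rw [abs_le]
    constructor <;> simp only [hi] <;> linarith
  have hz : ∀ l, |z l| ≤ R := fun l => (norm_le_pi_norm (WithLp.ofLp z) l).trans hR
  have hgrid : dist (WithLp.ofLp z) (gridPoint m k i) ≤ r := by
    refine (dist_pi_le_iff hr0.le).2 fun l => ?_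
    have h1 : z l - gridPoint m k i l = r * (H * z l - i l) := by
      simp only [gridPoint, ← hr]
      linear_combination (-z l) * hhr
    rw [Real.dist_eq, h1, abs_mul, abs_of_pos hr0]
    exact mul_le_of_le_one_right hr0.le (hfloor l)
  have hdist : dist z (WithLp.toLp 2 (gridPoint m k i)) ≤ D * r :=
    (hD (WithLp.ofLp z) (gridPoint m k i)).trans
      (mul_le_mul_of_nonneg_left hgrid (Nat.cast_nonneg D))
  refine hk ⟨i, ?_, ?_, n, Finset.mem_Icc.2 ⟨hn1, hn2⟩, ?_, ?_⟩
  · refine Fintype.mem_piFinset.2 fun l => Finset.mem_Icc.2 ⟨?_, ?_⟩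
    · refine Int.le_floor.2 ?_
      have := (abs_le.1 (hz l)).1
      push_cast
      rw [← hH]
      nlinarith
    · have h1 : ((i l : ℤ) : ℝ) ≤ ((R * 2 ^ (m * k) : ℤ) : ℝ) := by
        refine (Int.floor_le _).trans ?_
        have := (abs_le.1 (hz l)).2
        push_cast
        rw [← hH]
        nlinarith
      exact_mod_cast h1
  · refine le_trans (measureReal_mono (fun x hx => ?_) (measure_ne_top _ _)) hμ
    have h1 := fibreDist_le_add (F := F) hφ z (WithLp.toLp 2 (gridPoint m k i)) x
    have h2 : fibreDist hφ F (WithLp.toLp 2 (gridPoint m k i)) x < (D + 2) * r := by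
      have h3 : H * fibreDist hφ F (WithLp.toLp 2 (gridPoint m k i)) x < ((D + 2 : ℕ) : ℝ) := hx
      push_cast at h3
      refine lt_of_mul_lt_mul_left (a := H) ?_ hH0.le
      linear_combination h3 - (D + 2) * hhr
    change fibreDist hφ F z x < _
    push_cast
    linarith
  · refine one_le_plateau ?_
    norm_num
    refine (dist_pi_le_iff zero_le_one).2 fun l => ?_
    rw [Real.dist_eq]
    exact hfloor l
  · refine one_le_plateau ?_
    have h1 := fibreDist_le_add (F := F) hφ (WithLp.toLp 2 (gridPoint m k i)) z (T^[n] u)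
    rw [dist_comm] at h1
    have h2 : fibreDist hφ F (WithLp.toLp 2 (gridPoint m k i)) (T^[n] u) ≤ (D + 1) * r := by
      linarith
    have h3 := mul_le_mul_of_nonneg_left h2 hH0.le
    push_cast
    linear_combination h3 + (D + 1) * hhr

omit [MeasurableSpace X] in
-- Linear growth makes the Birkhoff sums unbounded, so the flow never stops: the fibre reached is
-- the one just before the first sum exceeding the height plus `t`.
theorem suspReaches_suspFlow {p : Susp φ} {c : ℝ} (hc : 0 < c)
    (hgrowth : ∀ n : ℕ, c * n ≤ birkhoffSum T φ n p.proj) {t : ℝ} (ht : 0 ≤ t) :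
    SuspReaches T φ t p (suspFlow T φ t p) := by
  have hex : ∃ q, SuspReaches T φ t p q := by
    have hs := p.2.1
    have hn : ∃ n : ℕ, p.1.2 + t < birkhoffSum T φ n p.1.1 := by
      obtain ⟨n, hn⟩ := exists_nat_gt ((p.1.2 + t) / c)
      refine ⟨n, lt_of_lt_of_le ?_ (hgrowth n)⟩
      rwa [div_lt_iff₀' hc] at hn
    classical
    obtain ⟨n, hn1⟩ : ∃ n, Nat.find hn = n + 1 := by
      refine Nat.exists_eq_succ_of_ne_zero fun h0 => ?_
      have := Nat.find_spec hn
      rw [h0, birkhoffSum_zero] at this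
      linarith
    have h1 := Nat.find_spec hn
    have h2 : ¬ _ := Nat.find_min hn (m := n) (by omega)
    rw [hn1, birkhoffSum_succ] at h1
    rw [not_lt] at h2
    exact ⟨⟨(T^[n] p.1.1, p.1.2 + t - birkhoffSum T φ n p.1.1), by dsimp only; linarith,
      by dsimp only; linarith⟩, n, rfl, by ring⟩
  rw [suspFlow, dif_pos hex]
  exact hex.choose_spec

theorem eventually_rpow_neg_le {α β c : ℝ} (hβ : 0 < β) (hαβ : β < α) (hc : 0 < c) (s : ℝ) :
    ∀ᶠ r : ℝ in 𝓝[>] 0, r ^ (-β) ≤ c * r ^ (-α) - s := by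
  have h1 : Tendsto (fun r : ℝ => r ^ (-(α - β))) (𝓝[>] 0) atTop :=
    tendsto_rpow_neg_nhdsGT_zero (by linarith)
  filter_upwards [h1.eventually_ge_atTop ((1 + |s|) / c),
    Ioo_mem_nhdsGT (zero_lt_one (α := ℝ))] with r hr hr01
  rw [div_le_iff₀' hc] at hr
  have h2 : 1 ≤ r ^ (-β) := Real.one_le_rpow_of_pos_of_le_one_of_nonpos hr01.1 hr01.2.le (by linarith)
  have h3 : r ^ (-α) = r ^ (-β) * r ^ (-(α - β)) := by
    rw [← Real.rpow_add hr01.1]; congr 1; ring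
  rw [h3]
  nlinarith [le_abs_self s, abs_nonneg s, mul_le_mul h2 hr (by positivity) (by positivity)]

theorem half_pow_rpow_le {m k l : ℕ} {b : ℝ} (h : (l : ℝ) ≤ m * b) :
    ((1 / 2 : ℝ) ^ (m * k)) ^ b ≤ (1 / 2) ^ (l * k) := by
  rw [← Real.rpow_natCast, ← Real.rpow_mul (by norm_num), ← Real.rpow_natCast]
  refine Real.rpow_le_rpow_of_exponent_ge (by norm_num) (by norm_num) ?_
  push_cast
  have : (0 : ℝ) ≤ k := Nat.cast_nonneg k
  nlinarith

/-- The exponent `b₀`, valid at all small scales, handles the intermediate times; the sharp exponent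
`b` is needed only at the single radius `C * r`. The same statement therefore serves for the liminf
and the limsup. -/
theorem exists_eventually_rpow_le_returnTime [IsProbabilityMeasure μ] (hφ : ∀ x, 0 < φ x) {N : ℕ}
    {F : Susp φ → EuclideanSpace ℝ (Fin N)} {y : Susp φ}
    (hshort : ∀ ρ c m j R : ℕ, ∀ᶠ k in atTop,
      ¬ ShortReturn μ T (fun z => fibreDist hφ F (WithLp.toLp 2 z)) ρ c m j R k
        (WithLp.ofLp (F y)) y.proj)
    {c₀ : ℝ} (hc₀ : 0 < c₀) (hgrowth : ∀ n : ℕ, c₀ * n ≤ birkhoffSum T φ n y.proj)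
    {b₀ : ℝ} (hb₀ : 0 < b₀)
    (hdim : ∀ᶠ r : ℝ in 𝓝[>] 0, μ.real {x | fibreDist hφ F (F y) x < r} ≤ r ^ b₀)
    {b β : ℝ} (hβ : 0 < β) (hb : β < b) :
    ∃ C : ℝ, 0 < C ∧ ∃ p : ℕ, ∀ᶠ r : ℝ in 𝓝[>] 0,
      μ.real {x | fibreDist hφ F (F y) x < C * r} ≤ (C * r) ^ b →
        ENNReal.ofReal (r ^ (-β)) ≤ returnTime (suspFlow T φ) F p r y := by
  set z := F y with hz
  set u := y.proj with hu
  obtain ⟨C, hC0, hC⟩ := exists_forall_eventually_le_fibreDist (μ := μ) (T := T) hφ F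
  have hC := hC z u hshort
  have hCpos : (0 : ℝ) < C := by exact_mod_cast hC0
  -- `m * b₀ > 3` gives windows `[2 ^ k, 2 ^ (2 k)]`, which chain together; `m * b > 2` allows `j +
  -- 2 = ⌊b m⌋`; `m * (b - β) > 2` absorbs the rounding and gives `β < (j + 1) / m`.
  obtain ⟨m, hm⟩ := exists_nat_gt (max (2 / (b - β)) (max (3 / b₀) (2 / b)))
  simp only [max_lt_iff] at hm
  obtain ⟨hm1, hm2, hm3⟩ := hm
  rw [div_lt_iff₀ (by linarith)] at hm1 hm2 hm3
  have hm0 : (0 : ℝ) < m := by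
    by_contra! h0
    nlinarith
  obtain ⟨j, hj⟩ := Nat.exists_eq_add_of_le'
    (Nat.le_floor (n := 2) (a := b * m) (by push_cast; linarith))
  have hj1 : ((j + 1 + 1 : ℕ) : ℝ) ≤ m * b := by
    rw [show j + 1 + 1 = ⌊b * m⌋₊ from hj.symm, mul_comm]
    exact Nat.floor_le (by nlinarith)
  have hj2 : β < ((j + 1 : ℕ) : ℝ) / m := by
    have := Nat.lt_floor_add_one (b * m)
    rw [hj] at this
    rw [lt_div_iff₀ hm0]
    push_cast at this ⊢
    linarith
  have hhalf : ∀ k : ℕ, (0 : ℝ) < (1 / 2) ^ (m * k) := fun k => by positivity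
  -- the orbit of `u` stays away from `z` at times in `[2 ^ k, 2 ^ (k + 1)]`, for all large `k`
  obtain ⟨k₀, hk₀⟩ : ∃ k₀ : ℕ, ∀ k ≥ k₀, ∀ n, 2 ^ k ≤ n → n ≤ 2 ^ (k + 1) →
      (1 / 2) ^ (m * k) ≤ fibreDist hφ F z (T^[n] u) := by
    obtain ⟨c, hc⟩ := exists_nat_ge ((C : ℝ) ^ b₀)
    have hlim : Tendsto (fun k : ℕ => (C : ℝ) * (1 / 2) ^ (m * k)) atTop (𝓝[>] 0) := by
      refine tendsto_nhdsWithin_iff.2 ⟨?_, Eventually.of_forall fun k => mul_pos hCpos (hhalf k)⟩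
      have hm0' : m ≠ 0 := by rintro rfl; simp at hm0
      have h1 := tendsto_pow_atTop_nhds_zero_of_lt_one
        (r := ((1 / 2 : ℝ)) ^ m) (by positivity) (pow_lt_one₀ (by norm_num) (by norm_num) hm0')
      simpa only [pow_mul, mul_zero] using h1.const_mul (C : ℝ)
    obtain ⟨k₀, hk₀⟩ := eventually_atTop.1
      (((hC c m 2).and (hlim.eventually hdim)).and (eventually_ge_atTop 1))
    refine ⟨k₀, fun k hk n hn1 hn2 => ?_⟩
    obtain ⟨⟨h1, h2⟩, h3⟩ := hk₀ k hk
    refine h1 (h2.trans ?_) n hn1 (hn2.trans (Nat.pow_le_pow_right two_pos (by omega)))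
    rw [Real.mul_rpow hCpos.le (hhalf k).le]
    exact mul_le_mul hc (half_pow_rpow_le (by push_cast; linarith)) (by positivity)
      (Nat.cast_nonneg c)
  obtain ⟨c, hc⟩ := exists_nat_ge (((C : ℝ) * 2 ^ m) ^ b)
  obtain ⟨k₁, hk₁⟩ := eventually_atTop.1 (hC c m (j + 1))
  -- By time `p` the flow has crossed `2 ^ k₀` fibres, so the iterates before the first controlled
  -- window do not count. This `p` does not depend on `r`.
  obtain ⟨p, hp⟩ := exists_nat_ge (birkhoffSum T φ (2 ^ k₀) u)
  refine ⟨C * 2 ^ m, by positivity, p, ?_⟩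
  filter_upwards [eventually_rpow_neg_le hβ hj2 (c := c₀ * (1 / 2) ^ (j + 1)) (by positivity) y.1.2,
    Ioo_mem_nhdsGT (hhalf (max k₀ k₁))] with r hr ⟨hr0, hr1⟩ hμ
  have hm1' : 1 ≤ m := by exact_mod_cast Nat.cast_pos.1 hm0
  -- The scale of `r`: `2 ^ (-m (k + 1)) < r ≤ 2 ^ (-m k)`. Passing to the larger radius `2 ^ (-m
  -- k)` costs at most the factor `2 ^ m`.
  obtain ⟨k, hkl, hkr⟩ := exists_nat_pow_near_of_lt_one hr0
    (hr1.le.trans (pow_le_one₀ (by norm_num) (by norm_num)))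
    (y := ((1 / 2 : ℝ)) ^ m) (by positivity) (pow_lt_one₀ (by norm_num) (by norm_num) (by omega))
  rw [← pow_mul] at hkl hkr
  have hk : max k₀ k₁ ≤ k := by
    have h1 := (pow_lt_pow_iff_right_of_lt_one₀ (by norm_num : (0 : ℝ) < 1 / 2)
      (by norm_num)).1 (hkl.trans hr1)
    have := Nat.lt_of_mul_lt_mul_left h1
    omega
  have hstep : (1 / 2 : ℝ) ^ (m * k) ≤ 2 ^ m * r := by
    have h1 : (1 / 2 : ℝ) ^ (m * k) = 2 ^ m * (1 / 2) ^ (m * (k + 1)) := by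
      rw [mul_add, mul_one, pow_add, mul_left_comm, ← mul_pow]; norm_num
    rw [h1]
    gcongr
  have hlate : ∀ n, 2 ^ k ≤ n → n ≤ 2 ^ ((j + 1) * k) →
      (1 / 2) ^ (m * k) ≤ fibreDist hφ F z (T^[n] u) := by
    refine hk₁ k (le_of_max_le_right hk) ?_
    calc μ.real {x | fibreDist hφ F z x < C * (1 / 2) ^ (m * k)}
        ≤ μ.real {x | fibreDist hφ F z x < C * 2 ^ m * r} := by
          refine measureReal_mono (fun x hx => ?_) (measure_ne_top _ _)
          refine lt_of_lt_of_le (show fibreDist hφ F z x < C * (1 / 2) ^ (m * k) from hx) ?_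
          rw [mul_assoc]
          gcongr
      _ ≤ (C * 2 ^ m * r) ^ b := hμ
      _ ≤ (C * 2 ^ m * (1 / 2) ^ (m * k)) ^ b := by gcongr; linarith
      _ = (C * 2 ^ m) ^ b * ((1 / 2) ^ (m * k)) ^ b :=
          Real.mul_rpow (by positivity) (by positivity)
      _ ≤ c * (1 / 2) ^ ((j + 1 + 1) * k) :=
          mul_le_mul hc (half_pow_rpow_le hj1) (by positivity) (Nat.cast_nonneg c)
  have hall : ∀ n, 2 ^ k₀ ≤ n → n ≤ 2 ^ ((j + 1) * k) → r ≤ fibreDist hφ F z (T^[n] u) := by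
    intro n hn1 hn2
    rcases le_or_gt (2 ^ k) n with hn | hn
    · exact hkr.trans (hlate n hn hn2)
    -- An earlier time lies in the dyadic window of `Nat.log 2 n < k`, where the orbit avoids an
    -- even larger sublevel set.
    · have hn0 : n ≠ 0 := (Nat.two_pow_pos k₀).trans_le hn1 |>.ne'
      have h1 : k₀ ≤ Nat.log 2 n := Nat.le_log_of_pow_le one_lt_two hn1
      have h2 : Nat.log 2 n < k := Nat.log_lt_of_lt_pow hn0 hn
      refine (hkr.trans ?_).trans (hk₀ _ h1 n (Nat.pow_log_le_self 2 hn0)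
        (Nat.lt_pow_succ_log_self one_lt_two n).le)
      exact pow_le_pow_of_le_one (by norm_num) (by norm_num) (Nat.mul_le_mul_left m h2.le)
  refine le_iInf₂ fun t ⟨htp, ht⟩ => ENNReal.ofReal_le_ofReal (hr.trans ?_)
  have ht0 : 0 ≤ t := (Nat.cast_nonneg p).trans htp.le
  obtain ⟨n, hn1, hn2⟩ := suspReaches_suspFlow hc₀ hgrowth ht0
  have hnear : fibreDist hφ F z (T^[n] u) < r :=
    (fibreDist_lt_iff hφ).2 ⟨suspFlow T φ t y, ht, hn1⟩
  have hq := (suspFlow T φ t y).2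
  have hy := y.2.1
  have hnbig : 2 ^ ((j + 1) * k) < n := by
    by_contra! hle
    refine hnear.not_ge (hall n ?_ hle)
    by_contra! hlt
    have h1 : birkhoffSum T φ (n + 1) u ≤ birkhoffSum T φ (2 ^ k₀) u :=
      Finset.sum_le_sum_of_subset_of_nonneg (Finset.range_mono hlt) fun i _ _ => (hφ _).le
    have h2 := hq.2
    rw [hn1] at h2
    rw [birkhoffSum_succ] at h1
    have h3 : y.1.2 + t = birkhoffSum T φ n u + (suspFlow T φ t y).1.2 := hn2
    have h4 : (suspFlow T φ t y).1.2 < φ (T^[n] u) := h2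
    linarith
  have hpow : r ^ (-(((j + 1 : ℕ) : ℝ) / m)) ≤ 2 ^ (j + 1) * 2 ^ ((j + 1) * k) := by
    have h1 : r ^ (-(((j + 1 : ℕ) : ℝ) / m)) ≤
        ((1 / 2 : ℝ) ^ (m * (k + 1))) ^ (-(((j + 1 : ℕ) : ℝ) / m)) :=
      Real.rpow_le_rpow_of_nonpos (hhalf _) hkl.le (by rw [neg_nonpos]; positivity)
    refine h1.trans (le_of_eq ?_)
    rw [← Real.rpow_natCast, ← Real.rpow_mul (by norm_num), ← pow_add, one_div,
      Real.inv_rpow two_pos.le, ← Real.rpow_neg two_pos.le, ← Real.rpow_natCast]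
    congr 1
    push_cast
    field_simp
    ring
  have hcast : (2 : ℝ) ^ ((j + 1) * k) ≤ n := by exact_mod_cast hnbig.le
  have h5 : y.1.2 + t = birkhoffSum T φ n u + (suspFlow T φ t y).1.2 := hn2
  have h6 : c₀ * (1 / 2) ^ (j + 1) * r ^ (-(((j + 1 : ℕ) : ℝ) / m)) ≤ c₀ * n := by
    calc _ ≤ c₀ * (1 / 2) ^ (j + 1) * (2 ^ (j + 1) * 2 ^ ((j + 1) * k)) := by gcongr
      _ = c₀ * 2 ^ ((j + 1) * k) := by
        rw [mul_assoc, ← mul_assoc ((1 / 2 : ℝ) ^ (j + 1)), ← mul_pow]; norm_num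
      _ ≤ c₀ * n := by gcongr
  have h7 := hgrowth n
  have h8 := hq.1
  linarith

end Deduction

/-! ### Recurrence rates and projection dimensions -/

section Rates

theorem measureReal_le_rpow_of_lt_log_div {X : Type*} [MeasurableSpace X] {μ : Measure X}
    [IsFiniteMeasure μ] {s : Set X} {b r : ℝ} (hr0 : 0 < r) (hr1 : r < 1)
    (h : (b : EReal) < ENNReal.log (μ s) / ((Real.log r : ℝ) : EReal)) : μ.real s ≤ r ^ b := by
  rcases (measureReal_nonneg (μ := μ) (s := s)).eq_or_lt with h0 | h0
  · rw [← h0]; positivity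
  · have hlog : ENNReal.log (μ s) = ((Real.log (μ.real s) : ℝ) : EReal) :=
      ENNReal.log_pos_real' h0
    rw [hlog, ← EReal.coe_div, EReal.coe_lt_coe_iff, lt_div_iff_of_neg (Real.log_neg hr0 hr1)] at h
    rw [← Real.log_le_log_iff h0 (by positivity), Real.log_rpow hr0]
    exact h.le

theorem le_log_div_of_rpow_le {τ : ℝ≥0∞} {β r : ℝ} (hr0 : 0 < r) (hr1 : r < 1)
    (h : ENNReal.ofReal (r ^ (-β)) ≤ τ) :
    (β : EReal) ≤ ENNReal.log τ / ((-Real.log r : ℝ) : EReal) := by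
  have hlog : 0 < -Real.log r := neg_pos.2 (Real.log_neg hr0 hr1)
  rw [EReal.le_div_iff_mul_le (by exact_mod_cast hlog) (EReal.coe_ne_top _), ← EReal.coe_mul]
  refine le_trans (le_of_eq ?_) (ENNReal.log_monotone h)
  rw [ENNReal.log_ofReal_of_pos (by positivity), Real.log_rpow hr0]
  congr 1
  ring

theorem tendsto_const_mul_nhdsGT_zero {C : ℝ} (hC : 0 < C) :
    Tendsto (fun r : ℝ => C * r) (𝓝[>] 0) (𝓝[>] 0) := by
  refine tendsto_nhdsWithin_iff.2 ⟨?_, ?_⟩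
  · have : Tendsto (fun r : ℝ => C * r) (𝓝 0) (𝓝 (C * 0)) := tendsto_id.const_mul C
    rw [mul_zero] at this
    exact this.mono_left nhdsWithin_le_nhds
  · filter_upwards [self_mem_nhdsWithin] with r hr
    exact mul_pos hC hr

variable {X : Type*} [MeasurableSpace X] {μ : Measure X} {T : X → X} {φ : X → ℝ}

theorem projDim_le_rate [IsProbabilityMeasure μ] (hφ : ∀ x, 0 < φ x) {N : ℕ}
    {F : Susp φ → EuclideanSpace ℝ (Fin N)} {y : Susp φ}
    (hshort : ∀ ρ c m j R : ℕ, ∀ᶠ k in atTop,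
      ¬ ShortReturn μ T (fun z => fibreDist hφ F (WithLp.toLp 2 z)) ρ c m j R k
        (WithLp.ofLp (F y)) y.proj)
    {c₀ : ℝ} (hc₀ : 0 < c₀) (hgrowth : ∀ n : ℕ, c₀ * n ≤ birkhoffSum T φ n y.proj)
    (hpos : 0 < lowerProjDim μ F (F y)) :
    lowerProjDim μ F (F y) ≤ lowerRate (suspFlow T φ) F y ∧
      upperProjDim μ F (F y) ≤ upperRate (suspFlow T φ) F y := by
  have hset : ∀ r, {x | fibreDist hφ F (F y) x < r} =
      Susp.proj '' (F ⁻¹' Metric.ball (F y) r) := fun r => Set.ext fun x => fibreDist_lt_iff hφ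
  have hunit : ∀ᶠ r : ℝ in 𝓝[>] 0, 0 < r ∧ r < 1 := Ioo_mem_nhdsGT zero_lt_one
  have hmeas : ∀ (b r : ℝ), (0 < r ∧ r < 1) →
      (b : EReal) < ENNReal.log (μ (Susp.proj '' (F ⁻¹' Metric.ball (F y) r))) /
        ((Real.log r : ℝ) : EReal) → μ.real {x | fibreDist hφ F (F y) x < r} ≤ r ^ b := by
    intro b r hr h
    rw [hset]
    exact measureReal_le_rpow_of_lt_log_div hr.1 hr.2 h
  obtain ⟨b₀, hb₀, hb₀d⟩ := EReal.lt_iff_exists_real_btwn.1 hpos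
  have hb₀ : 0 < b₀ := by exact_mod_cast hb₀
  have hdim : ∀ᶠ r : ℝ in 𝓝[>] 0, μ.real {x | fibreDist hφ F (F y) x < r} ≤ r ^ b₀ := by
    filter_upwards [hunit, eventually_lt_of_lt_liminf hb₀d] with r hr h using hmeas b₀ r hr h
  have key := fun {b β : ℝ} => exists_eventually_rpow_le_returnTime (b := b) (β := β) hφ hshort
    hc₀ hgrowth hb₀ hdim
  have hbetween : ∀ {d : EReal} {a : ℝ}, 0 < d → (a : EReal) < d →
      ∃ β b : ℝ, 0 < β ∧ a ≤ β ∧ β < b ∧ (b : EReal) < d := by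
    intro d a hd ha
    -- The return time bound needs `β > 0`, while `a` may be negative.
    have h1 : ((max a 0 : ℝ) : EReal) < d := by
      rcases max_choice a 0 with h | h <;> rw [h]
      · exact ha
      · exact_mod_cast hd
    obtain ⟨b, hb, hbd⟩ := EReal.lt_iff_exists_real_btwn.1 h1
    obtain ⟨β, hβ, hβb⟩ := exists_between (EReal.coe_lt_coe_iff.1 hb)
    exact ⟨β, b, (le_max_right _ _).trans_lt hβ, (le_max_left _ _).trans hβ.le, hβb, hbd⟩
  have hpos' : 0 < upperProjDim μ F (F y) := hpos.trans_le liminf_le_limsup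
  constructor
  · refine EReal.ge_of_forall_gt_iff_ge.1 fun a ha => ?_
    obtain ⟨β, b, hβ, haβ, hβb, hbd⟩ := hbetween hpos ha
    obtain ⟨C, hC, p, hp⟩ := key hβ hβb
    refine le_trans (EReal.coe_le_coe_iff.2 haβ) (le_trans ?_
      (le_iSup (fun p => lowerRateFrom (suspFlow T φ) F p y) p))
    refine le_liminf_of_le (by isBoundedDefault) ?_
    filter_upwards [hp, hunit, (tendsto_const_mul_nhdsGT_zero hC).eventually hunit,
      (tendsto_const_mul_nhdsGT_zero hC).eventually (eventually_lt_of_lt_liminf hbd)]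
      with r h1 h2 h3 h4
    exact le_log_div_of_rpow_le h2.1 h2.2 (h1 (hmeas b _ h3 h4))
  · refine EReal.ge_of_forall_gt_iff_ge.1 fun a ha => ?_
    obtain ⟨β, b, hβ, haβ, hβb, hbd⟩ := hbetween hpos' ha
    obtain ⟨C, hC, p, hp⟩ := key hβ hβb
    refine le_trans (EReal.coe_le_coe_iff.2 haβ) (le_trans ?_
      (le_iSup (fun p => upperRateFrom (suspFlow T φ) F p y) p))
    refine le_limsup_of_frequently_le ?_ (by isBoundedDefault)
    -- The limsup provides good radii for the measure; the return time is evaluated at these radii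
    -- divided by `C`.
    have hfreq := (frequently_lt_of_lt_limsup (by isBoundedDefault) hbd).and_eventually
      ((tendsto_const_mul_nhdsGT_zero (inv_pos.2 hC)).eventually (hp.and hunit) |>.and hunit)
    refine (tendsto_const_mul_nhdsGT_zero (inv_pos.2 hC)).frequently
      (p := fun r => (β : EReal) ≤
        ENNReal.log (returnTime (suspFlow T φ) F p r y) / ((-Real.log r : ℝ) : EReal))
      (hfreq.mono ?_)
    rintro r ⟨h4, ⟨h1, h2⟩, h3⟩
    rw [mul_inv_cancel_left₀ hC.ne'] at h1
    exact le_log_div_of_rpow_le h2.1 h2.2 (h1 (hmeas b _ h3 h4))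

end Rates

/-! ### The almost everywhere statement and its transfer through the isomorphism -/

theorem ae_projDim_le_rate {X : Type*} [PseudoMetricSpace X] [MeasurableSpace X]
    [OpensMeasurableSpace X] {μ : Measure X} [IsProbabilityMeasure μ] {T : X → X}
    (hTμ : MeasurePreserving T μ μ) (hTLip : ∃ K : ℝ≥0, LipschitzWith K T)
    (hT : SuperPolynomialDecay T μ) {φ : X → ℝ} (hφ : ∀ x, 0 < φ x) (hφm : Measurable φ)
    (hφi : Integrable φ μ) {N : ℕ} {F : Susp φ → EuclideanSpace ℝ (Fin N)}
    (hF : BWLipschitz T φ F) :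
    ∀ᵐ y ∂(suspMeasure μ φ), 0 < lowerProjDim μ F (F y) →
      lowerProjDim μ F (F y) ≤ lowerRate (suspFlow T φ) F y ∧
      upperProjDim μ F (F y) ≤ upperRate (suspFlow T φ) F y := by
  filter_upwards [ae_eventually_not_shortReturn_susp hTμ.measurable hTLip hT hφ hφm hF,
    ae_suspMeasure_proj hφ hφm (ae_exists_mul_le_birkhoffSum hTμ hφ hφm hφi)]
    with y hy ⟨c, hc, hgrowth⟩ hpos
  exact projDim_le_rate hφ hy hc hgrowth hpos

/-- Only times `t > p ≥ 0` enter, so intertwining in forward time suffices. -/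
theorem returnTime_eq_of_semiconj {Z W E : Type*} [PseudoMetricSpace E] {Φ : ℝ → Z → Z}
    {Ψ : ℝ → W → W} {g : Z → W} {y : Z} (h : ∀ t, 0 ≤ t → g (Φ t y) = Ψ t (g y)) (f : W → E)
    (p : ℕ) (r : ℝ) : returnTime Ψ f p r (g y) = returnTime Φ (f ∘ g) p r y := by
  unfold returnTime
  refine iInf_congr fun t => iInf_congr_Prop ?_ fun _ => rfl
  refine and_congr_right fun ht => ?_
  rw [Function.comp_apply, Function.comp_apply, h t ((Nat.cast_nonneg p).trans ht.le)]

/-- A property of almost every point of the suspension passes to almost every point of an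
isomorphic flow. -/
theorem IsMetricIsomorphism.ae_exists {X M : Type*} [MeasurableSpace X] [MeasurableSpace M]
    {T : X → X} {φ : X → ℝ} {μ : Measure X} {Ψ : ℝ → M → M} {ν : Measure M}
    [IsProbabilityMeasure ν] {g : Susp φ → M} (hg : IsMetricIsomorphism T φ μ Ψ ν g)
    {P : Susp φ → Prop} (hP : ∀ᵐ y ∂(suspMeasure μ φ), P y) :
    ∀ᵐ x ∂ν, ∃ y, g y = x ∧ P y ∧ ∀ t, 0 ≤ t → g (suspFlow T φ t y) = Ψ t (g y) := by
  obtain ⟨Y', M', hY', hM', -, hνM', hbij, hflow, -, himage⟩ := hg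
  -- The measure of an image is known only for measurable sets, so the bad set is first enlarged to
  -- a measurable null set.
  obtain ⟨s, hs, hsm, hs0⟩ := exists_measurable_superset_of_null (ae_iff.1 hP)
  have h1 : ν (g '' (s ∩ Y')) = 0 := by
    rw [← himage _ inter_subset_right (hsm.inter hY')]
    exact measure_mono_null inter_subset_left hs0
  have h2 : ∀ᵐ x ∂ν, x ∈ M' := (prob_compl_eq_zero_iff hM').2 hνM'
  filter_upwards [h2, measure_eq_zero_iff_ae_notMem.1 h1] with x hx hxs
  obtain ⟨y, hy, rfl⟩ := hbij.surjOn hx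
  refine ⟨y, rfl, ?_, fun t ht => (hflow t ht y hy).2⟩
  by_contra hn
  exact hxs ⟨y, ⟨hs hn, hy⟩, rfl⟩

theorem theorem3p4 {X : Type*} [MetricSpace X] [MeasurableSpace X] [OpensMeasurableSpace X]
    (μ : Measure X) [IsProbabilityMeasure μ]
    (T : X → X) (hTμ : MeasurePreserving T μ μ) (hTLip : ∃ K : ℝ≥0, LipschitzWith K T)
    (hT : SuperPolynomialDecay T μ)
    (φ : X → ℝ) (hφpos : ∀ x, 0 < φ x) (hφm : Measurable φ) (hφi : Integrable φ μ) (N : ℕ) :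
    -- observations of a flow that is metrically isomorphic to the suspension flow
    (∀ {M : Type*} [MetricSpace M] [MeasurableSpace M] [BorelSpace M]
        (Ψ : ℝ → M → M) (_ : IsMeasurableFlow Ψ)
        (ν : Measure M) [IsProbabilityMeasure ν] (_ : ∀ t, MeasurePreserving (Ψ t) ν ν)
        (g : Susp φ → M) (_ : IsMetricIsomorphism T φ μ Ψ ν g) (_ : BWLipschitz T φ g)
        (f : M → EuclideanSpace ℝ (Fin N)) (_ : ∃ K : ℝ≥0, LipschitzWith K f),
        ∀ᵐ x ∂ν, 0 < lowerProjDim μ (f ∘ g) (f x) →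
          lowerProjDim μ (f ∘ g) (f x) ≤ lowerRate Ψ f x ∧
          upperProjDim μ (f ∘ g) (f x) ≤ upperRate Ψ f x) ∧
    -- observations of the suspension flow itself
    (∀ F : Susp φ → EuclideanSpace ℝ (Fin N), BWLipschitz T φ F →
        ∀ᵐ y ∂(suspMeasure μ φ), 0 < lowerProjDim μ F (F y) →
          lowerProjDim μ F (F y) ≤ lowerRate (suspFlow T φ) F y ∧
          upperProjDim μ F (F y) ≤ upperRate (suspFlow T φ) F y) := by
  refine ⟨?_, fun F hF => ae_projDim_le_rate hTμ hTLip hT hφpos hφm hφi hF⟩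
  intro M _ _ _ Ψ _ ν _ _ g hg hgLip f hf
  have hfg : BWLipschitz T φ (f ∘ g) := by
    obtain ⟨K, hK⟩ := hgLip
    obtain ⟨L, hL⟩ := hf
    refine ⟨L * K, fun p q => (hL.dist_le_mul _ _).trans ?_⟩
    have := mul_le_mul_of_nonneg_left (hK p q) L.2
    push_cast
    rw [mul_assoc]
    exact this
  filter_upwards [hg.ae_exists (ae_projDim_le_rate hTμ hTLip hT hφpos hφm hφi hfg)]
    with x ⟨y, hyx, hy, hflow⟩ hpos
  subst hyx
  have hlower : lowerRate Ψ f (g y) = lowerRate (suspFlow T φ) (f ∘ g) y := by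
    simp only [lowerRate, lowerRateFrom, returnTime_eq_of_semiconj hflow]
  have hupper : upperRate Ψ f (g y) = upperRate (suspFlow T φ) (f ∘ g) y := by
    simp only [upperRate, upperRateFrom, returnTime_eq_of_semiconj hflow]
  rw [hlower, hupper]
  exact hy hpos
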